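/- **Theorem 1.** For an integer $k\ge 0$, a *first-order sentence with $k$ variables* is a first-order sentence in the language of graphs (adjacency and equality) that uses at most $k$ distinct variables, each of which may be quantified repeatedly. Two graphs $G,H$ are *$k$-distinguishable* if some first-order sentence $\varphi$ with $k$ variables satisfies $G\models\varphi$ and $H\not\models\varphi$. Let $G_n^1,G_n^2$ be chosen independently and uniformly at random from the set of all graphs on $[n]=\{1,\dots,n\}$. For real $x\in[1,n]$ let $$f^{\mathrm{ext}}(x)=f^{\mathrm{ext}}_n(x)=\ln\left(\binom{n}{x}2^x\left(1-2^{-x}\right)^{n-x}\right),\qquad \binom{n}{x}=\frac{\Gamma(n+1)}{\Gamma(x+1)\Gamma(n-x+1)}.$$ For all sufficiently large $n$ the equation $f^{\mathrm{ext}}(x)=0$ has exactly one root $\hat k=\hat k(n)$ in $[1,n]$, and $$\hat k=\log_2 n-2\log_2\ln n+\log_2\ln 2+o(1)\qquad(n\to\infty).$$ 1. The minimum $k$ for which there is a (non-random, possibly depending on $n$) first-order sentence $\varphi$ with $k$ variables such that $\mathsf P(G_n^1\models\varphi,\ G_n^2\not\models\varphi)=\frac14-o(1)$ belongs to $\{\lfloor\hat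 k\rfloor+1,\dots,\lfloor\hat k\rfloor+4\}$. That is: for every fixed $\varepsilon\in(0,\frac14)$ and all sufficiently large $n$, the least $k$ for which some first-order sentence $\varphi$ with $k$ variables satisfies $\mathsf P(G_n^1\models\varphi,\ G_n^2\not\models\varphi)\ge\frac14-\varepsilon$ exists and belongs to $\{\lfloor\hat k\rfloor+1,\dots,\lfloor\hat k\rfloor+4\}$. Moreover, there are sentences $\varphi_n$ with $\lfloor\hat k\rfloor+4$ variables such that $\mathsf P(G_n^1\models\varphi_n,\ G_n^2\not\models\varphi_n)\to\frac14$; and whenever sentences $\varphi_n$ with $k_n$ variables satisfy $\mathsf P(G_n^1\models\varphi_n,\ G_n^2\not\models\varphi_n)\to\frac14$, then $k_n\ge\lfloor\hat k\rfloor+1$ for all sufficiently large $n$. 2. With probability tending to $1$ as $n\to\infty$, the minimum $k$ for which $G_n^1$ and $G_n^2$ are $k$-distinguishable exists and belongs to $\{\lfloor\hat k\rfloor+1,\lfloor\hat k\rfloor+2,\lfloor\hat k\rfloor+3\}$. -/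

import Mathlib

noncomputable section

namespace RandomGraphLogic

/-- First-order formulas in the language of graphs (equality and adjacency) whose variables, free or
bound, all belong to a fixed list `x₀, …, x_{k-1}` of `k` variables. A variable may be quantified
again inside the scope of a quantifier over the same variable, as usual in `k`-variable logic.
Negation, conjunction, disjunction and `∃` are expressible from `⊥`, `→` and `∀`. -/
inductive GraphFormula (k : ℕ) : Type
  | falsum : GraphFormula k
  | equal (i j : Fin k) : GraphFormula k
  | adj (i j : Fin k) : GraphFormula k
  | imp (φ ψ : GraphFormula k) : GraphFormula k
  | all (i : Fin k) (φ : GraphFormula k) : GraphFormula k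

namespace GraphFormula

/-- The set of variables that occur free in a formula. -/
def freeVars {k : ℕ} : GraphFormula k → Finset (Fin k)
  | falsum => ∅
  | equal i j => {i, j}
  | adj i j => {i, j}
  | imp φ ψ => φ.freeVars ∪ ψ.freeVars
  | all i φ => φ.freeVars.erase i

/-- Truth of a formula in the graph `G` under the assignment `v` of vertices to the variables. -/
def Realize {k : ℕ} {V : Type*} (G : SimpleGraph V) : GraphFormula k → (Fin k → V) → Prop
  | falsum, _ => False
  | equal i j, v => v i = v j
  | adj i j, v => G.Adj (v i) (v j)
  | imp φ ψ, v => φ.Realize G v → ψ.Realize G v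
  | all i φ, v => ∀ a : V, φ.Realize G (Function.update v i a)

end GraphFormula

/-- First-order sentences about graphs with (at most) `k` variables. -/
def GraphSentence (k : ℕ) : Type :=
  {φ : GraphFormula k // φ.freeVars = ∅}

/-- `Models G φ` is `G ⊨ φ`. On a nonempty vertex set the truth value of a sentence does not depend
on the assignment. -/
def Models {k : ℕ} {V : Type*} (G : SimpleGraph V) (φ : GraphSentence k) : Prop :=
  ∀ v : Fin k → V, φ.1.Realize G v

/-- `G` and `H` are `k`-distinguishable: some first-order sentence with `k` variables holds in `G`
and fails in `H`. -/
def Distinguishable {V W : Type*} (k : ℕ) (G : SimpleGraph V) (H : SimpleGraph W) : Prop :=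
  ∃ φ : GraphSentence k, Models G φ ∧ ¬ Models H φ

/-- The probability that `E G H` holds when `G` and `H` are chosen independently and uniformly at
random among all (labelled) graphs on `n` vertices, i.e. when the pair `(G, H)` is uniform among all
pairs of such graphs. -/
def pairProb (n : ℕ) (E : SimpleGraph (Fin n) → SimpleGraph (Fin n) → Prop) : ℝ :=
  (Nat.card {p : SimpleGraph (Fin n) × SimpleGraph (Fin n) // E p.1 p.2} : ℝ) /
    (Nat.card (SimpleGraph (Fin n) × SimpleGraph (Fin n)) : ℝ)

/-- The probability that the fixed sentence `φ` holds in the first and fails in the second of two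
independent uniform random graphs on `n` vertices. -/
def separationProb (n : ℕ) {k : ℕ} (φ : GraphSentence k) : ℝ :=
  pairProb n fun G H => Models G φ ∧ ¬ Models H φ

/-- The logarithm of `(n choose x) 2 ^ x (1 - 2 ^ (-x)) ^ (n - x)`, where the binomial coefficient is
extended to real `x ∈ [0, n]` by the Gamma function. -/
def fExt (n : ℕ) (x : ℝ) : ℝ :=
  Real.log (Real.Gamma ((n : ℝ) + 1) / (Real.Gamma (x + 1) * Real.Gamma ((n : ℝ) - x + 1)) *
    (2 : ℝ) ^ x * (1 - (2 : ℝ) ^ (-x)) ^ ((n : ℝ) - x))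

end RandomGraphLogic

end

namespace RandomGraphLogic

/-! ### The extension property and the pebble game -/

/-! Write W = (ln n)² / ln 2. For s ~ log₂ n the factor n^s is exp((1+o(1))W), and at the root k̂
one has n·2^(-k̂) ~ W, so every estimate is a comparison of multiples of W in an exponent.

Lower bounds. If both graphs have the extension property for sets of at most m vertices, Duplicator
wins the pebble game with m + 1 pebbles, hence no sentence with at most m + 1 variables tells them
apart (`not_distinguishable_of_hasExtensions`). With m = ⌊k̂⌋ - 1 one has n/2^m ≥ (3/2)W, and the
union bound (2n)^m (1 - 2^(-m))^(n-m) for a violation has exponent at most (1 - 3/2 + o(1))W, so it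
tends to 0.

Upper bounds. Put s = ⌊k̂⌋ + 2 and forbid a set 𝒜 of two or three ways in which an outside vertex
may attach to an s-tuple. A tuple is avoiding if no outside vertex attaches in a forbidden way,
which costs about exp(-λ) with λ = n|𝒜|/2^s. The choice between two and three patterns keeps λ/W
above 1/2 by a margin and λ small enough that the expected number of avoiding tuples tends to
infinity. A second moment argument then gives an avoiding tuple with high probability. A prescribed
induced graph F costs a further 2^(-s(s-1)/2) = exp(-(1/2+o(1))W), so for each fixed F an avoiding
tuple inducing F is unlikely, uniformly in F (`exists_patterns`). The sentence "some avoiding tuple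
induces a graph in ℱ" needs only s + 1 = ⌊k̂⌋ + 3 variables.

For two random graphs, take F from an avoiding tuple of the first graph; the independent second
graph most likely has no avoiding tuple inducing F. For a fixed sentence, enlarge ℱ one graph at a
time: the probability of the sentence climbs from 0 to almost 1 in steps of size o(1), so it passes
within o(1) of 1/2, and independence turns P(1 - P) into 1/4 - o(1).

The second moment works because distinct patterns disagree somewhere on every set of about 2s/3
positions. For tuples with a large overlap, a forbidden trace on one then determines the forbidden
trace on the other, so the two avoidance events are only mildly correlated; for tuples with a small
overlap they are almost independent. -/

/-- Every way of attaching a new vertex to at most `m` vertices of `G` is realised in `G`. -/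
def HasExtensions {V : Type*} (G : SimpleGraph V) (m : ℕ) : Prop :=
  ∀ (T : Finset V) (A : Set V), T.card ≤ m → ∃ y ∉ T, ∀ t ∈ T, G.Adj t y ↔ t ∈ A

/-- The assignments `v` and `w` induce a partial isomorphism on the variables in `D`. -/
def PartialIso {V W : Type*} {k : ℕ} (G : SimpleGraph V) (H : SimpleGraph W) (D : Finset (Fin k))
    (v : Fin k → V) (w : Fin k → W) : Prop :=
  ∀ i ∈ D, ∀ j ∈ D, (v i = v j ↔ w i = w j) ∧ (G.Adj (v i) (v j) ↔ H.Adj (w i) (w j))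

namespace PartialIso

variable {V W : Type*} {k : ℕ} {G : SimpleGraph V} {H : SimpleGraph W} {v : Fin k → V}
  {w : Fin k → W}

theorem symm {D : Finset (Fin k)} (h : PartialIso G H D v w) : PartialIso H G D w v :=
  fun i hi j hj => ⟨(h i hi j hj).1.symm, (h i hi j hj).2.symm⟩

theorem mono {D E : Finset (Fin k)} (hED : E ⊆ D) (h : PartialIso G H D v w) :
    PartialIso G H E v w :=
  fun i hi j hj => h i (hED hi) j (hED hj)

/-- The forth step of the pebble game. -/
theorem exists_update {m : ℕ} (hk : k ≤ m + 1) (hH : HasExtensions H m) {D : Finset (Fin k)}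
    {i : Fin k} (h : PartialIso G H (D.erase i) v w) (a : V) :
    ∃ b : W, PartialIso G H D (Function.update v i a) (Function.update w i b) := by
  classical
  suffices hb : ∃ b : W, ∀ j ∈ D.erase i, (v j = a ↔ w j = b) ∧ (G.Adj (v j) a ↔ H.Adj (w j) b) by
    obtain ⟨b, hb⟩ := hb
    refine ⟨b, fun j hj l hl => ?_⟩
    by_cases hji : j = i <;> by_cases hli : l = i
    · subst hji; subst hli; simp
    · subst hji
      have := hb l (Finset.mem_erase.2 ⟨hli, hl⟩)
      simp only [Function.update_self, Function.update_of_ne hli]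
      rw [eq_comm, this.1, eq_comm, G.adj_comm, this.2, H.adj_comm]
      simp
    · subst hli
      have := hb j (Finset.mem_erase.2 ⟨hji, hj⟩)
      simpa only [Function.update_self, Function.update_of_ne hji] using this
    · simpa only [Function.update_of_ne hli, Function.update_of_ne hji] using
        h j (Finset.mem_erase.2 ⟨hji, hj⟩) l (Finset.mem_erase.2 ⟨hli, hl⟩)
  -- If `a` already carries a pebble, the reply is the partner of that pebble; otherwise the reply
  -- is a fresh vertex supplied by the extension property.
  by_cases ha : ∃ l ∈ D.erase i, v l = a
  · obtain ⟨l, hl, rfl⟩ := ha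
    exact ⟨w l, fun j hj => h j hj l hl⟩
  · push Not at ha
    -- With variable `i` freed, at most k - 1 ≤ m pebbles remain on the board; this is what fixes
    -- the relation between m and k.
    have hcard : ((D.erase i).image w).card ≤ m := by
      refine Finset.card_image_le.trans ?_
      have h1 : (D.erase i).card ≤ (Finset.univ.erase i).card :=
        Finset.card_le_card (Finset.erase_subset_erase _ (Finset.subset_univ _))
      rw [Finset.card_erase_of_mem (Finset.mem_univ i), Finset.card_univ, Fintype.card_fin] at h1
      omega
    obtain ⟨b, hbT, hb⟩ := hH ((D.erase i).image w)
      {c | ∃ j ∈ D.erase i, w j = c ∧ G.Adj (v j) a} hcard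
    refine ⟨b, fun j hj => ⟨iff_of_false (ha j hj) ?_, ?_⟩⟩
    · rintro rfl
      exact hbT (Finset.mem_image_of_mem w hj)
    · rw [hb (w j) (Finset.mem_image_of_mem w hj)]
      constructor
      · exact fun hadj => ⟨j, hj, rfl, hadj⟩
      · rintro ⟨l, hl, hlj, hadj⟩
        rwa [← (h l hl j hj).1.2 hlj]

end PartialIso

namespace GraphFormula

/-- Induction on the formula. Only the free variables have to match, so a quantifier releases its
variable and the back and forth steps of the pebble game reassign it. -/
theorem realize_iff_of_hasExtensions {V W : Type*} {k m : ℕ} (hk : k ≤ m + 1) {G : SimpleGraph V}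
    {H : SimpleGraph W} (hG : HasExtensions G m) (hH : HasExtensions H m) (φ : GraphFormula k) :
    ∀ {v : Fin k → V} {w : Fin k → W}, PartialIso G H φ.freeVars v w →
      (φ.Realize G v ↔ φ.Realize H w) := by
  induction φ with
  | falsum => intro v w _; rfl
  | equal i j => intro v w h; exact (h i (by simp [freeVars]) j (by simp [freeVars])).1
  | adj i j => intro v w h; exact (h i (by simp [freeVars]) j (by simp [freeVars])).2
  | imp φ ψ ihφ ihψ =>
    intro v w h
    exact imp_congr (ihφ (h.mono Finset.subset_union_left)) (ihψ (h.mono Finset.subset_union_right))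
  | all i φ ih =>
    intro v w h
    constructor
    · intro hv b
      obtain ⟨a, ha⟩ := h.symm.exists_update hk hG b
      exact (ih ha.symm).1 (hv a)
    · intro hw a
      obtain ⟨b, hb⟩ := h.exists_update hk hH a
      exact (ih hb).2 (hw b)

end GraphFormula

/-- A sentence has no free variables, so any two assignments form a partial isomorphism to start
from. Nonemptiness of `V` excludes vacuous truth in `G`. -/
theorem not_distinguishable_of_hasExtensions {V W : Type*} {k m : ℕ} (hk : k ≤ m + 1) [Nonempty V]
    {G : SimpleGraph V} {H : SimpleGraph W} (hG : HasExtensions G m) (hH : HasExtensions H m) :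
    ¬ Distinguishable k G H := by
  rintro ⟨φ, hφG, hφH⟩
  refine hφH fun w => ?_
  have hiso : PartialIso G H φ.1.freeVars (fun _ => Classical.arbitrary V) w := by
    rw [φ.2]; simp [PartialIso]
  exact (φ.1.realize_iff_of_hasExtensions hk hG hH hiso).1 (hφG _)

/-! ### Sentences describing configurations -/

namespace GraphFormula

variable {k : ℕ} {V : Type*} {G : SimpleGraph V} {v : Fin k → V}

/-- Negation. -/
def neg (φ : GraphFormula k) : GraphFormula k := imp φ falsum

/-- Conjunction. -/
def conj (φ ψ : GraphFormula k) : GraphFormula k := neg (imp φ (neg ψ))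

/-- Conjunction of a family of formulas over a finset. -/
noncomputable def allOf {ι : Type*} (S : Finset ι) (φ : ι → GraphFormula k) : GraphFormula k :=
  (S.toList.map φ).foldr conj (neg falsum)

/-- Disjunction of a family of formulas over a finset. -/
noncomputable def anyOf {ι : Type*} (S : Finset ι) (φ : ι → GraphFormula k) : GraphFormula k :=
  neg (allOf S fun i => neg (φ i))

/-- `φ` if `p` holds and the negation of `φ` otherwise. -/
def signed (p : Prop) [Decidable p] (φ : GraphFormula k) : GraphFormula k :=
  if p then φ else neg φ

@[simp] theorem realize_neg (φ : GraphFormula k) : (neg φ).Realize G v ↔ ¬ φ.Realize G v := Iff.rfl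

@[simp] theorem realize_imp (φ ψ : GraphFormula k) :
    (imp φ ψ).Realize G v ↔ (φ.Realize G v → ψ.Realize G v) := Iff.rfl

@[simp] theorem realize_equal (i j : Fin k) : (equal i j).Realize G v ↔ v i = v j := Iff.rfl

@[simp] theorem realize_adj (i j : Fin k) : (adj i j).Realize G v ↔ G.Adj (v i) (v j) := Iff.rfl

@[simp] theorem realize_all (i : Fin k) (φ : GraphFormula k) :
    (all i φ).Realize G v ↔ ∀ a, φ.Realize G (Function.update v i a) := Iff.rfl

@[simp] theorem realize_conj (φ ψ : GraphFormula k) :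
    (conj φ ψ).Realize G v ↔ φ.Realize G v ∧ ψ.Realize G v := by
  simp [conj]

@[simp] theorem realize_signed (p : Prop) [Decidable p] (φ : GraphFormula k) :
    (signed p φ).Realize G v ↔ (φ.Realize G v ↔ p) := by
  unfold signed; split_ifs with h <;> simp [h]

@[simp] theorem realize_allOf {ι : Type*} (S : Finset ι) (φ : ι → GraphFormula k) :
    (allOf S φ).Realize G v ↔ ∀ i ∈ S, (φ i).Realize G v := by
  have key : ∀ l : List ι, ((l.map φ).foldr conj (neg falsum)).Realize G v ↔
      ∀ i ∈ l, (φ i).Realize G v := by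
    intro l
    induction l with
    | nil => simp [Realize]
    | cons a l ih => simp [ih]
  simpa [allOf] using key S.toList

@[simp] theorem realize_anyOf {ι : Type*} (S : Finset ι) (φ : ι → GraphFormula k) :
    (anyOf S φ).Realize G v ↔ ∃ i ∈ S, (φ i).Realize G v := by
  simp [anyOf]

/-- Universal quantification over the variables in a list. -/
def closeAll : List (Fin k) → GraphFormula k → GraphFormula k
  | [], φ => φ
  | i :: l, φ => all i (closeAll l φ)

theorem freeVars_closeAll (l : List (Fin k)) (φ : GraphFormula k) :
    (closeAll l φ).freeVars ⊆ φ.freeVars \ l.toFinset := by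
  induction l with
  | nil => simp [closeAll]
  | cons i l ih =>
    intro j hj
    simp only [closeAll, freeVars, Finset.mem_erase] at hj
    have := ih hj.2
    simp_all

theorem realize_closeAll (l : List (Fin k)) (φ : GraphFormula k) :
    (closeAll l φ).Realize G v ↔ ∀ u : Fin k → V, (∀ i ∉ l, u i = v i) → φ.Realize G u := by
  induction l generalizing v with
  | nil =>
    simp only [closeAll, List.not_mem_nil, not_false_eq_true, forall_true_left]
    exact ⟨fun h u hu => by rwa [funext hu], fun h => h v fun _ => rfl⟩
  | cons i l ih =>
    simp only [closeAll, realize_all, ih]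
    constructor
    · intro h u hu
      refine h (u i) u fun j hj => ?_
      by_cases hji : j = i
      · subst hji; simp
      · rw [Function.update_of_ne hji]; exact hu j (by simp [hji, hj])
    · intro h a u hu
      refine h u fun j hj => ?_
      simp only [List.mem_cons, not_or] at hj
      rw [hu j hj.2, Function.update_of_ne hj.1]

/-- The sentence saying that some assignment satisfies `φ`. -/
def exClosure (φ : GraphFormula k) : GraphSentence k :=
  ⟨neg (closeAll (List.finRange k) (neg φ)), by
    have := freeVars_closeAll (List.finRange k) (neg φ)
    have h : (List.finRange k).toFinset = Finset.univ := by ext; simp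
    rw [h, Finset.sdiff_eq_empty_iff_subset.2 (Finset.subset_univ _), Finset.subset_empty] at this
    simpa [neg, freeVars] using this⟩

theorem models_exClosure [Nonempty V] (φ : GraphFormula k) :
    Models G φ.exClosure ↔ ∃ v : Fin k → V, φ.Realize G v := by
  have : ∀ v : Fin k → V, φ.exClosure.1.Realize G v ↔ ∃ u : Fin k → V, φ.Realize G u := by
    intro v
    simp [exClosure, realize_closeAll]
  simp [Models, this]

end GraphFormula

/-- The way in which the vertex `y` attaches to the tuple `x`: the indices of its neighbours. -/
def trace {V W : Type*} (G : SimpleGraph V) (x : W → V) (y : V) : Set W := {i | G.Adj (x i) y}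

/-- No vertex outside the tuple `x` attaches to `x` in one of the ways listed in `𝒜`. -/
def Avoids {V W : Type*} (G : SimpleGraph V) (𝒜 : Finset (Set W)) (x : W ↪ V) : Prop :=
  ∀ y ∉ Set.range x, trace G x y ∉ 𝒜

open Classical in
/-- The formula saying that the first `s` variables are distinct, induce a graph in `ℱ`, and that no
other vertex attaches to them in one of the ways listed in `𝒜`. -/
noncomputable def configFormula {s k : ℕ} (hk : s + 1 ≤ k) (𝒜 : Finset (Set (Fin s)))
    (ℱ : Finset (SimpleGraph (Fin s))) : GraphFormula k :=
  let x : Fin s → Fin k := fun i => ⟨i, by omega⟩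
  let z : Fin k := ⟨s, by omega⟩
  .conj (.allOf Finset.univ fun p : Fin s × Fin s => .signed (p.1 = p.2) (.equal (x p.1) (x p.2)))
    (.conj (.anyOf ℱ fun F => .allOf Finset.univ fun p : Fin s × Fin s =>
        .signed (F.Adj p.1 p.2) (.adj (x p.1) (x p.2)))
      (.all z (.imp (.allOf Finset.univ fun i => .neg (.equal z (x i)))
        (.allOf 𝒜 fun A => .neg (.allOf Finset.univ fun i => .signed (i ∈ A) (.adj (x i) z))))))

/-- One variable beyond the tuple is enough: it is quantified over all outside vertices, and which
patterns and graphs are listed costs no variables. -/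
theorem models_configFormula {V : Type*} [Nonempty V] (G : SimpleGraph V) {s k : ℕ} (hk : s + 1 ≤ k)
    (𝒜 : Finset (Set (Fin s))) (ℱ : Finset (SimpleGraph (Fin s))) :
    Models G (configFormula hk 𝒜 ℱ).exClosure ↔
      ∃ x : Fin s ↪ V, G.comap x ∈ ℱ ∧ Avoids G 𝒜 x := by
  rw [GraphFormula.models_exClosure]
  have hne : ∀ (i : Fin s), (⟨i, by omega⟩ : Fin k) ≠ ⟨s, by omega⟩ := by
    intro i h
    have := i.2
    simp only [Fin.mk.injEq] at h
    omega
  simp only [configFormula, GraphFormula.realize_conj, GraphFormula.realize_allOf,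
    GraphFormula.realize_signed, GraphFormula.realize_equal, GraphFormula.realize_anyOf,
    GraphFormula.realize_adj, GraphFormula.realize_all, GraphFormula.realize_imp,
    GraphFormula.realize_neg, Function.update_self, Function.update_of_ne (hne _),
    Finset.mem_univ, true_imp_iff, Prod.forall]
  constructor
  · rintro ⟨v, hinj, ⟨F, hF, hadj⟩, hav⟩
    refine ⟨⟨fun i => v ⟨i, by omega⟩, fun i j hij => (hinj i j).1 hij⟩, ?_, ?_⟩
    · convert hF
      ext i j
      exact hadj i j
    · intro y hy hmem
      refine hav y (fun i hi => hy ⟨i, hi.symm⟩) _ hmem fun i => Iff.rfl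
  · rintro ⟨x, hF, hav⟩
    have hs : Nonempty V := inferInstance
    -- The values beyond the first s variables do not matter: variable s is requantified and later
    -- ones do not occur.
    refine ⟨fun i => if h : (i : ℕ) < s then x ⟨i, h⟩ else Classical.arbitrary V, ?_, ?_, ?_⟩
    · intro i j; simp
    · exact ⟨_, hF, fun i j => by simp⟩
    · intro y hy A hA hadj
      refine hav y ?_ ?_
      · rintro ⟨i, rfl⟩; exact hy i (by simp)
      · convert hA
        ext i
        simpa [trace] using hadj i

end RandomGraphLogic

namespace RandomGraphLogic

/-! ### Uniform probability on a finite type -/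

/-- The probability of the event `E` for a uniformly random element of `α`. -/
noncomputable def uprob {α : Type*} (E : α → Prop) : ℝ := (Nat.card {a // E a} : ℝ) / (Nat.card α : ℝ)

section Uniform

variable {α β : Type*}

theorem uprob_nonneg (E : α → Prop) : 0 ≤ uprob E := by unfold uprob; positivity

theorem uprob_congr {E F : α → Prop} (h : ∀ a, E a ↔ F a) : uprob E = uprob F := by
  rw [show E = F from funext fun a => propext (h a)]

theorem uprob_mono [Finite α] {E F : α → Prop} (h : ∀ a, E a → F a) : uprob E ≤ uprob F := by
  unfold uprob
  gcongr
  exact Nat.card_mono (Set.toFinite {a | F a}) (fun a ha => h a ha)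

theorem uprob_true [Finite α] [Nonempty α] : uprob (fun _ : α => True) = 1 := by
  unfold uprob
  rw [Nat.card_congr (Equiv.subtypeUnivEquiv fun _ => trivial)]
  exact div_self (by exact_mod_cast Nat.card_pos.ne')

theorem uprob_false : uprob (fun _ : α => False) = 0 := by
  simp [uprob]

theorem uprob_le_one [Finite α] [Nonempty α] (E : α → Prop) : uprob E ≤ 1 :=
  (uprob_mono fun _ _ => trivial).trans uprob_true.le

open Classical in
theorem uprob_eq_sum [Fintype α] (E : α → Prop) :
    uprob E = (∑ a, if E a then (1 : ℝ) else 0) / Fintype.card α := by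
  rw [uprob, Nat.card_eq_fintype_card, Nat.card_eq_fintype_card, Fintype.card_subtype]
  simp

theorem uprob_or_add_and [Finite α] (E F : α → Prop) :
    uprob (fun a => E a ∨ F a) + uprob (fun a => E a ∧ F a) = uprob E + uprob F := by
  classical
  have := Fintype.ofFinite α
  simp only [uprob_eq_sum, ← add_div, ← Finset.sum_add_distrib]
  congr 1
  refine Finset.sum_congr rfl fun a _ => ?_
  by_cases h1 : E a <;> by_cases h2 : F a <;> simp [h1, h2]

theorem uprob_not [Finite α] [Nonempty α] (E : α → Prop) :
    uprob (fun a => ¬ E a) = 1 - uprob E := by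
  have h := uprob_or_add_and E fun a => ¬ E a
  simp only [em, and_not_self, uprob_true, uprob_false] at h
  linarith

theorem uprob_or_le [Finite α] (E F : α → Prop) :
    uprob (fun a => E a ∨ F a) ≤ uprob E + uprob F := by
  linarith [uprob_or_add_and E F, uprob_nonneg fun a => E a ∧ F a]

theorem uprob_exists_le [Finite α] {ι : Type*} [Fintype ι] (E : ι → α → Prop) :
    uprob (fun a => ∃ i, E i a) ≤ ∑ i, uprob (E i) := by
  classical
  have := Fintype.ofFinite α
  simp only [uprob_eq_sum, ← Finset.sum_div]
  rw [Finset.sum_comm]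
  gcongr with a
  split_ifs with h
  · obtain ⟨i, hi⟩ := h
    have := Finset.single_le_sum (f := fun i => if E i a then (1 : ℝ) else 0)
      (fun j _ => by positivity) (Finset.mem_univ i)
    simpa [hi] using this
  · exact Finset.sum_nonneg fun j _ => by positivity

theorem uprob_equiv (e : α ≃ β) (E : β → Prop) : uprob (fun a => E (e a)) = uprob E := by
  unfold uprob
  rw [Nat.card_congr e, Nat.card_congr (e.subtypeEquiv (p := fun a => E (e a)) fun a => Iff.rfl)]

theorem uprob_prod (E : α → Prop) (F : β → Prop) :
    uprob (fun p : α × β => E p.1 ∧ F p.2) = uprob E * uprob F := by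
  unfold uprob
  rw [Nat.card_prod, Nat.card_congr (Equiv.subtypeProdEquivProd (p := E) (q := F)), Nat.card_prod]
  push_cast
  exact (div_mul_div_comm _ _ _ _).symm

theorem uprob_fst [Finite β] [Nonempty β] (E : α → Prop) :
    uprob (fun p : α × β => E p.1) = uprob E := by
  simpa [uprob_true] using uprob_prod E fun _ : β => True

theorem uprob_snd [Finite α] [Nonempty α] (E : β → Prop) :
    uprob (fun p : α × β => E p.2) = uprob E := by
  simpa [uprob_true] using uprob_prod (fun _ : α => True) E

theorem uprob_forall {ι : Type*} [Fintype ι] (E : α → Prop) :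
    uprob (fun f : ι → α => ∀ i, E (f i)) = uprob E ^ Fintype.card ι := by
  unfold uprob
  rw [Nat.card_congr (Equiv.subtypePiEquivPi (p := fun _ : ι => E)), Nat.card_pi, Nat.card_pi]
  simp [div_pow]

/-- If an event has conditional probability at most `ε` given the first coordinate, then it has
probability at most `ε`. -/
theorem uprob_prod_le [Finite α] [Nonempty α] [Finite β] {ε : ℝ} (E : α → β → Prop)
    (h : ∀ a, uprob (E a) ≤ ε) :
    uprob (fun p : α × β => E p.1 p.2) ≤ ε := by
  classical
  have := Fintype.ofFinite α
  have := Fintype.ofFinite β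
  have h1 : uprob (fun p : α × β => E p.1 p.2) = (∑ a, uprob (E a)) / Fintype.card α := by
    simp only [uprob_eq_sum, ← Finset.sum_div, Fintype.card_prod, Nat.cast_mul,
      Fintype.sum_prod_type, div_div]
    rw [mul_comm]
  rw [h1, div_le_iff₀ (by exact_mod_cast Fintype.card_pos)]
  calc ∑ a, uprob (E a) ≤ ∑ _a : α, ε := Finset.sum_le_sum fun a _ => h a
    _ = ε * Fintype.card α := by simp [mul_comm]

/-- The second moment method. -/
theorem sq_sum_uprob_le [Finite α] {ι : Type*} [Fintype ι] (E : ι → α → Prop) :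
    (∑ i, uprob (E i)) ^ 2 ≤
      uprob (fun a => ∃ i, E i a) * ∑ i, ∑ j, uprob (fun a => E i a ∧ E j a) := by
  classical
  have := Fintype.ofFinite α
  set X : α → ℝ := fun a => ∑ i, if E i a then (1 : ℝ) else 0 with hX
  have h1 : ∑ i, uprob (E i) = (∑ a, X a) / Fintype.card α := by
    simp only [uprob_eq_sum, ← Finset.sum_div, hX]
    rw [Finset.sum_comm]
  have h2 : ∑ i, ∑ j, uprob (fun a => E i a ∧ E j a) = (∑ a, X a ^ 2) / Fintype.card α := by
    simp only [uprob_eq_sum, ← Finset.sum_div, hX]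
    congr 1
    refine (Finset.sum_congr rfl fun i _ => Finset.sum_comm).trans ?_
    rw [Finset.sum_comm]
    refine Finset.sum_congr rfl fun a _ => ?_
    rw [sq, Finset.sum_mul_sum]
    refine Finset.sum_congr rfl fun i _ => Finset.sum_congr rfl fun j _ => ?_
    by_cases hi : E i a <;> by_cases hj : E j a <;> simp [hi, hj]
  rw [h1, h2, uprob_eq_sum, div_pow, div_mul_div_comm, ← sq]
  gcongr
  have h3 := Finset.sum_mul_sq_le_sq_mul_sq Finset.univ
    (fun a => if ∃ i, E i a then (1 : ℝ) else 0) X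
  have h4 : ∀ a, (if ∃ i, E i a then (1 : ℝ) else 0) * X a = X a := by
    intro a
    split_ifs with h
    · simp
    · push Not at h; simp [hX, h]
  simp only [h4] at h3
  refine h3.trans_eq ?_
  congr 1
  exact Finset.sum_congr rfl fun a _ => by split_ifs <;> simp

end Uniform

/-! ### Random subsets -/

section RandomSets

/-- A subset of a disjoint union is a pair of subsets. -/
def setSumEquiv (W Y : Type*) : Set (W ⊕ Y) ≃ Set W × Set Y where
  toFun D := (Sum.inl ⁻¹' D, Sum.inr ⁻¹' D)
  invFun p := {z | Sum.elim (· ∈ p.1) (· ∈ p.2) z}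
  left_inv D := by ext (z | z) <;> rfl
  right_inv p := by ext <;> rfl

open Classical in
/-- The vertex set is the disjoint union of the range of a tuple and its complement. -/
noncomputable def sumComplEquiv {W V : Type*} (x : W ↪ V) : W ⊕ {y // y ∉ Set.range x} ≃ V :=
  (Equiv.sumCongr (Equiv.ofInjective x x.injective) (Equiv.refl _)).trans
    (Equiv.Set.sumCompl (Set.range x))

/-- A random set consists of independent uniform parts on and off the range of `x`, so its trace
along an injection is again uniform. -/
theorem uprob_preimage {W V : Type*} [Finite V] (x : W ↪ V) (P : Set W → Prop) :
    uprob (fun D : Set V => P (x ⁻¹' D)) = uprob P := by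
  rw [← uprob_fst (β := Set {y // y ∉ Set.range x}) P, ← uprob_equiv
    ((Equiv.Set.congr (sumComplEquiv x)).symm.trans (setSumEquiv W _))]
  refine uprob_congr fun D => ?_
  have : ((Equiv.Set.congr (sumComplEquiv x)).symm.trans (setSumEquiv W _) D).1 = x ⁻¹' D := by
    change Sum.inl ⁻¹' ((sumComplEquiv x).symm '' D) = x ⁻¹' D
    rw [Equiv.image_symm_eq_preimage]
    rfl
  rw [this]

theorem uprob_mem_finset {α : Type*} (S : Finset α) :
    uprob (fun a => a ∈ S) = S.card / (Nat.card α : ℝ) := by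
  simp [uprob]

theorem natCard_set (W : Type*) [Finite W] : Nat.card (Set W) = 2 ^ Nat.card W := by
  have := Fintype.ofFinite W
  simp [Nat.card_eq_fintype_card]

end RandomSets

/-! ### Exposing the edges at a tuple of vertices -/

section Expose

/-- A graph on a disjoint union consists of graphs on the two parts and the edges in between. -/
def graphSumEquiv (W Y : Type*) :
    SimpleGraph (W ⊕ Y) ≃ SimpleGraph W × (Y → Set W) × SimpleGraph Y where
  toFun G := (G.comap Sum.inl, fun y => {w | G.Adj (Sum.inl w) (Sum.inr y)}, G.comap Sum.inr)
  invFun p :=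
    { Adj := fun a b => match a, b with
        | .inl w, .inl w' => p.1.Adj w w'
        | .inl w, .inr y => w ∈ p.2.1 y
        | .inr y, .inl w => w ∈ p.2.1 y
        | .inr y, .inr y' => p.2.2.Adj y y'
      symm := ⟨by
        rintro (a | a) (b | b) h
        exacts [SimpleGraph.Adj.symm h, h, h, SimpleGraph.Adj.symm h]⟩
      loopless := ⟨by
        rintro (a | a) h
        exacts [p.1.loopless.irrefl _ h, p.2.2.loopless.irrefl _ h]⟩ }
  left_inv G := by
    ext (a | a) (b | b)
    · rfl
    · rfl
    · exact G.adj_comm _ _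
    · rfl
  right_inv p := rfl

variable {W V : Type*}

/-- A graph consists of the graph induced on a tuple `x`, the traces of the other vertices on `x`,
and the graph induced on the other vertices. -/
noncomputable def graphExposeEquiv (x : W ↪ V) :
    SimpleGraph V ≃ SimpleGraph W × ({y // y ∉ Set.range x} → Set W) ×
      SimpleGraph {y // y ∉ Set.range x} :=
  (Equiv.simpleGraph (sumComplEquiv x).symm).trans (graphSumEquiv W _)

theorem graphExposeEquiv_fst (x : W ↪ V) (G : SimpleGraph V) :
    (graphExposeEquiv x G).1 = G.comap x := by
  rfl

theorem graphExposeEquiv_snd_fst (x : W ↪ V) (G : SimpleGraph V) (y : {y // y ∉ Set.range x}) :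
    (graphExposeEquiv x G).2.1 y = trace G x y := by
  rfl

theorem natCard_compl_range [Finite V] (x : W ↪ V) :
    Nat.card {y // y ∉ Set.range x} = Nat.card V - Nat.card W := by
  have : Finite W := Finite.of_injective x x.injective
  rw [← Nat.card_congr (sumComplEquiv x), Nat.card_sum]
  omega

/-- The graph inside the tuple, the traces of the outside vertices and the graph outside are
independent and uniform. This is the source of every probability computed below. -/
theorem uprob_expose [Finite V] (x : W ↪ V) (Q : SimpleGraph W → Prop) (P : Set W → Prop) :
    uprob (fun G : SimpleGraph V => Q (G.comap x) ∧ ∀ y ∉ Set.range x, P (trace G x y)) =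
      uprob Q * uprob P ^ (Nat.card V - Nat.card W) := by
  have := Fintype.ofFinite {y // y ∉ Set.range x}
  rw [← natCard_compl_range x, Nat.card_eq_fintype_card, ← uprob_forall,
    ← uprob_fst (β := SimpleGraph {y // y ∉ Set.range x})
      (fun f : {y // y ∉ Set.range x} → Set W => ∀ i, P (f i)), ← uprob_prod,
    ← uprob_equiv (graphExposeEquiv x)]
  refine uprob_congr fun G => ?_
  simp only [graphExposeEquiv_fst, graphExposeEquiv_snd_fst, Subtype.forall]

theorem natCard_simpleGraph_fin (s : ℕ) : Nat.card (SimpleGraph (Fin s)) = 2 ^ s.choose 2 := by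
  induction s with
  | zero => simp
  | succ s ih =>
    have h := Nat.card_congr (graphSumEquiv (Fin s) (Fin 1))
    rw [Nat.card_prod, Nat.card_prod, ih, Nat.card_pi] at h
    rw [Nat.card_congr (Equiv.simpleGraph (finSumFinEquiv (m := s) (n := 1)).symm), h, natCard_set]
    simp [Nat.choose_succ_succ', ← pow_add, add_comm]

end Expose

end RandomGraphLogic

namespace RandomGraphLogic

open Finset

/-! ### First moment bounds -/

section Moments

variable {n s : ℕ}

theorem natCard_set_fin (s : ℕ) : (Nat.card (Set (Fin s)) : ℝ) = 2 ^ s := by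
  simp

theorem uprob_not_mem (𝒜 : Finset (Set (Fin s))) :
    uprob (fun A => A ∉ 𝒜) = 1 - 𝒜.card / 2 ^ s := by
  rw [uprob_not, uprob_mem_finset, natCard_set_fin]

theorem uprob_avoids (𝒜 : Finset (Set (Fin s))) (x : Fin s ↪ Fin n) :
    uprob (fun G : SimpleGraph (Fin n) => Avoids G 𝒜 x) =
      (1 - 𝒜.card / 2 ^ s : ℝ) ^ (n - s) := by
  have h := uprob_expose x (fun _ => True) (fun A => A ∉ 𝒜)
  simpa [uprob_true, uprob_not_mem, Avoids] using h

theorem uprob_avoids_and_comap_eq (𝒜 : Finset (Set (Fin s))) (F : SimpleGraph (Fin s))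
    (x : Fin s ↪ Fin n) :
    uprob (fun G : SimpleGraph (Fin n) => G.comap x = F ∧ Avoids G 𝒜 x) =
      1 / 2 ^ s.choose 2 * (1 - 𝒜.card / 2 ^ s : ℝ) ^ (n - s) := by
  have h := uprob_expose x (fun F' => F' = F) (fun A => A ∉ 𝒜)
  rw [uprob_not_mem] at h
  have hF : uprob (fun F' : SimpleGraph (Fin s) => F' = F) = 1 / 2 ^ s.choose 2 := by
    rw [uprob, natCard_simpleGraph_fin]
    simp
  simpa [hF, Avoids] using h

theorem card_embedding_fin (n s : ℕ) : Fintype.card (Fin s ↪ Fin n) = n.descFactorial s := by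
  simp [Fintype.card_embedding_eq]

theorem one_sub_div_two_pow_nonneg (𝒜 : Finset (Set (Fin s))) :
    (0 : ℝ) ≤ 1 - 𝒜.card / 2 ^ s := by
  rw [← uprob_not_mem]; exact uprob_nonneg _

/-- The expected number of avoiding tuples inducing a given graph bounds the probability that there
is one. -/
theorem uprob_exists_avoids_comap_eq_le (𝒜 : Finset (Set (Fin s))) (F : SimpleGraph (Fin s)) :
    uprob (fun G : SimpleGraph (Fin n) => ∃ x : Fin s ↪ Fin n, G.comap x = F ∧ Avoids G 𝒜 x) ≤
      n ^ s * (1 / 2 ^ s.choose 2 * (1 - 𝒜.card / 2 ^ s : ℝ) ^ (n - s)) := by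
  refine (uprob_exists_le _).trans ?_
  simp only [uprob_avoids_and_comap_eq, Finset.sum_const, Finset.card_univ, nsmul_eq_mul,
    card_embedding_fin]
  have := one_sub_div_two_pow_nonneg 𝒜
  gcongr
  exact_mod_cast Nat.descFactorial_le_pow n s

/-- Union bound over m-tuples and the 2^m possible patterns on each of them. -/
theorem uprob_not_hasExtensions_le {m : ℕ} (hmn : m ≤ n) :
    uprob (fun G : SimpleGraph (Fin n) => ¬ HasExtensions G m) ≤
      (2 * n) ^ m * (1 - 1 / 2 ^ m : ℝ) ^ (n - m) := by
  have key : ∀ G : SimpleGraph (Fin n), ¬ HasExtensions G m →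
      ∃ p : (Fin m ↪ Fin n) × Set (Fin m), Avoids G {p.2} p.1 := by
    intro G hG
    contrapose! hG
    intro T A hT
    -- Smaller sets are padded to exactly m vertices, so only full m-tuples have to be counted.
    obtain ⟨T', hTT', hT'⟩ := Finset.exists_superset_card_eq hT (by simpa using hmn)
    let x : Fin m ↪ Fin n := (T'.equivFinOfCardEq hT').symm.toEmbedding.trans
      (Function.Embedding.subtype _)
    have hx : ∀ t ∈ T', ∃ i, x i = t := fun t ht =>
      ⟨T'.equivFinOfCardEq hT' ⟨t, ht⟩, by simp [x]⟩
    have h := hG (x, x ⁻¹' A)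
    simp only [Avoids, not_forall, Finset.mem_singleton, not_not] at h
    obtain ⟨y, hy, htr⟩ := h
    refine ⟨y, fun hyT => hy (hx y (hTT' hyT)), fun t ht => ?_⟩
    obtain ⟨i, rfl⟩ := hx t (hTT' ht)
    exact Set.ext_iff.1 htr i
  refine (uprob_mono key).trans ((uprob_exists_le _).trans ?_)
  simp only [uprob_avoids, Finset.sum_const, Finset.card_univ, nsmul_eq_mul, Fintype.card_prod,
    card_embedding_fin, Fintype.card_set, Fintype.card_fin, Finset.card_singleton, Nat.cast_one]
  have : (0 : ℝ) ≤ 1 - 1 / 2 ^ m := by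
    rw [sub_nonneg, div_le_one (by positivity)]
    exact one_le_pow₀ (by norm_num)
  gcongr
  rw [mul_pow, mul_comm]
  push_cast
  gcongr
  exact_mod_cast Nat.descFactorial_le_pow n m

/-! ### Second moment bounds -/

/-- Two different members of `𝒜` do not agree on `r` indices. -/
def Separated (𝒜 : Finset (Set (Fin s))) (r : ℕ) : Prop :=
  ∀ A ∈ 𝒜, ∀ B ∈ 𝒜, ∀ I : Finset (Fin s), r ≤ I.card → (∀ i ∈ I, i ∈ A ↔ i ∈ B) → A = B

open Classical in
/-- The indices at which the tuple `x'` meets the tuple `x`. -/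
noncomputable def meet (x x' : Fin s ↪ Fin n) : Finset (Fin s) := {i | x' i ∈ Set.range x}

theorem card_union_range_add_card_meet (x x' : Fin s ↪ Fin n) :
    Nat.card ↥(Set.range x ∪ Set.range x') + (meet x x').card = 2 * s := by
  classical
  have h1 : Nat.card ↥(Set.range x ∪ Set.range x') = (univ.image x ∪ univ.image x').card := by
    rw [← Nat.card_eq_fintype_card.trans (Fintype.card_coe (univ.image x ∪ univ.image x'))]
    exact Nat.card_congr (Equiv.subtypeEquivRight fun a => by simp)
  have h2 : (meet x x').card = (univ.image x ∩ univ.image x').card := by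
    rw [← Finset.card_image_of_injective (meet x x') x'.injective]
    congr 1
    ext a
    simp only [meet, mem_image, mem_filter, mem_univ, true_and, mem_inter, Set.mem_range]
    constructor
    · rintro ⟨i, hi, rfl⟩; exact ⟨hi, i, rfl⟩
    · rintro ⟨hi, i, rfl⟩; exact ⟨i, hi, rfl⟩
  rw [h1, h2, Finset.card_union_add_card_inter, Finset.card_image_of_injective _ x.injective,
    Finset.card_image_of_injective _ x'.injective]
  simp [two_mul]

theorem natCard_subtype_le_of_injOn {α β : Type*} {P : α → Prop} (S : Finset β) (f : α → β)
    (hf : ∀ a, P a → f a ∈ S) (hinj : ∀ a b, P a → P b → f a = f b → a = b) :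
    Nat.card {a // P a} ≤ S.card := by
  rw [← Nat.card_eq_fintype_card.trans (Fintype.card_coe S)]
  exact Nat.card_le_card_of_injective (fun a : {a // P a} => (⟨f a, hf a a.2⟩ : S))
    fun a b hab => Subtype.ext (hinj a b a.2 b.2 (by simpa using hab))

/-- The first of two tuples, viewed inside the union of their ranges. -/
def leftIncl (x x' : Fin s ↪ Fin n) : Fin s ↪ ↥(Set.range x ∪ Set.range x') where
  toFun i := ⟨x i, Or.inl ⟨i, rfl⟩⟩
  inj' _ _ h := x.injective (congrArg Subtype.val h)

/-- The second of two tuples, viewed inside the union of their ranges. -/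
def rightIncl (x x' : Fin s ↪ Fin n) : Fin s ↪ ↥(Set.range x ∪ Set.range x') where
  toFun i := ⟨x' i, Or.inr ⟨i, rfl⟩⟩
  inj' _ _ h := x'.injective (congrArg Subtype.val h)

theorem ext_of_preimage_incl {x x' : Fin s ↪ Fin n} {D E : Set ↥(Set.range x ∪ Set.range x')}
    (hl : leftIncl x x' ⁻¹' D = leftIncl x x' ⁻¹' E)
    (hr : rightIncl x x' ⁻¹' D = rightIncl x x' ⁻¹' E) : D = E := by
  ext ⟨a, ⟨i, rfl⟩ | ⟨i, rfl⟩⟩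
  · exact Set.ext_iff.1 hl i
  · exact Set.ext_iff.1 hr i

/-- A bound `b` for the number of traces that are forbidden for both tuples bounds the probability
that both tuples are avoiding. -/
theorem uprob_avoids_and_avoids_le_pow (𝒜 : Finset (Set (Fin s))) (x x' : Fin s ↪ Fin n) {b : ℕ}
    {β : ℝ} (hb : Nat.card {D : Set ↥(Set.range x ∪ Set.range x') //
      leftIncl x x' ⁻¹' D ∈ 𝒜 ∧ rightIncl x x' ⁻¹' D ∈ 𝒜} ≤ b)
    (hβ : 1 - 2 * (𝒜.card / 2 ^ s) + b / 2 ^ (2 * s - (meet x x').card) ≤ β) :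
    uprob (fun G : SimpleGraph (Fin n) => Avoids G 𝒜 x ∧ Avoids G 𝒜 x') ≤ β ^ (n - 2 * s) := by
  classical
  have hcard := card_union_range_add_card_meet x x'
  set U := Set.range x ∪ Set.range x' with hU
  set P : Set U → Prop := fun D => leftIncl x x' ⁻¹' D ∉ 𝒜 ∧ rightIncl x x' ⁻¹' D ∉ 𝒜 with hP
  have h1 : uprob (fun G : SimpleGraph (Fin n) => Avoids G 𝒜 x ∧ Avoids G 𝒜 x') ≤
      uprob P ^ (n - Nat.card U) := by
    have h := uprob_expose (Function.Embedding.subtype (· ∈ U)) (fun _ => True) P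
    rw [uprob_true, one_mul, Nat.card_fin] at h
    -- Only vertices outside both tuples are tested: their traces on the union are independent and
    -- uniform.
    refine (uprob_mono fun G hG => ?_).trans h.le
    refine ⟨trivial, fun y hy => ?_⟩
    have hyU : y ∉ U := fun h => hy ⟨⟨y, h⟩, rfl⟩
    exact ⟨hG.1 y fun h => hyU (Or.inl h), hG.2 y fun h => hyU (Or.inr h)⟩
  have h2 : uprob P ≤ 1 - 2 * (𝒜.card / 2 ^ s) + b / 2 ^ (2 * s - (meet x x').card) := by
    have e1 : uprob P = 1 - uprob fun D : Set U =>
        leftIncl x x' ⁻¹' D ∈ 𝒜 ∨ rightIncl x x' ⁻¹' D ∈ 𝒜 := by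
      rw [← uprob_not]
      exact uprob_congr fun D => by simp [hP]
    have e2 := uprob_or_add_and (fun D : Set U => leftIncl x x' ⁻¹' D ∈ 𝒜)
      fun D => rightIncl x x' ⁻¹' D ∈ 𝒜
    rw [uprob_preimage (leftIncl x x') (· ∈ 𝒜), uprob_preimage (rightIncl x x') (· ∈ 𝒜),
      uprob_mem_finset, natCard_set_fin] at e2
    have e3 : uprob (fun D : Set U => leftIncl x x' ⁻¹' D ∈ 𝒜 ∧ rightIncl x x' ⁻¹' D ∈ 𝒜) ≤
        b / 2 ^ (2 * s - (meet x x').card) := by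
      rw [uprob, natCard_set, show Nat.card U = 2 * s - (meet x x').card by omega]
      push_cast
      gcongr
    linarith
  refine h1.trans ((pow_le_pow_of_le_one (uprob_nonneg _) (uprob_le_one _) ?_).trans
    (pow_le_pow_left₀ (uprob_nonneg _) (h2.trans hβ) _))
  omega

/-- Small overlap: a trace on the union is determined by its two restrictions, so at most |𝒜|²
traces are forbidden twice, out of at least 2^(2s-r). The correction to independence is therefore
tiny. -/
theorem uprob_avoids_and_avoids_le_of_card_meet_le {𝒜 : Finset (Set (Fin s))}
    {x x' : Fin s ↪ Fin n} {r : ℕ} (h : (meet x x').card ≤ r) :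
    uprob (fun G : SimpleGraph (Fin n) => Avoids G 𝒜 x ∧ Avoids G 𝒜 x') ≤
      ((1 - 𝒜.card / 2 ^ s) ^ 2 + 𝒜.card ^ 2 / 2 ^ (2 * s - r) : ℝ) ^ (n - 2 * s) := by
  refine (uprob_avoids_and_avoids_le_pow 𝒜 x x' (b := (𝒜 ×ˢ 𝒜).card) ?_ ?_)
  · refine natCard_subtype_le_of_injOn _
      (fun D => (leftIncl x x' ⁻¹' D, rightIncl x x' ⁻¹' D)) (fun D hD => ?_) ?_
    · simpa using hD
    · intro D E _ _ h
      exact ext_of_preimage_incl (congrArg Prod.fst h) (congrArg Prod.snd h)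
  · rw [Finset.card_product]
    push_cast
    rw [← sq]
    have h1 : (𝒜.card ^ 2 / 2 ^ (2 * s - (meet x x').card) : ℝ) ≤ 𝒜.card ^ 2 / 2 ^ (2 * s - r) := by
      gcongr
      norm_num
    nlinarith [sq_nonneg (𝒜.card / 2 ^ s : ℝ)]

/-- Large overlap: the restriction to the first tuple fixes the second pattern on the common
vertices, and separation then fixes the whole pattern. So at most |𝒜| traces are forbidden twice. As
the ranges differ, the union has at least s + 1 vertices, so these traces have density at most p/2
for p = |𝒜|/2^s, and 1 - 2p + p/2 = 1 - 3p/2. -/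
theorem uprob_avoids_and_avoids_le_of_separated {𝒜 : Finset (Set (Fin s))}
    {x x' : Fin s ↪ Fin n} {r : ℕ} (h𝒜 : Separated 𝒜 r) (h : r ≤ (meet x x').card)
    (hlt : (meet x x').card < s) :
    uprob (fun G : SimpleGraph (Fin n) => Avoids G 𝒜 x ∧ Avoids G 𝒜 x') ≤
      (1 - 3 / 2 * (𝒜.card / 2 ^ s) : ℝ) ^ (n - 2 * s) := by
  refine (uprob_avoids_and_avoids_le_pow 𝒜 x x' (b := 𝒜.card) ?_ ?_)
  · refine natCard_subtype_le_of_injOn _ (fun D => leftIncl x x' ⁻¹' D) (fun D hD => hD.1) ?_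
    intro D E hD hE hDE
    refine ext_of_preimage_incl hDE (h𝒜 _ hD.2 _ hE.2 (meet x x') h fun i hi => ?_)
    simp only [meet, Finset.mem_filter, Set.mem_range, Finset.mem_univ, true_and] at hi
    obtain ⟨l, hl⟩ := hi
    have : rightIncl x x' i = leftIncl x x' l := Subtype.ext hl.symm
    rw [Set.mem_preimage, Set.mem_preimage, this]
    exact Set.ext_iff.1 hDE l
  · have h1 : (𝒜.card / 2 ^ (2 * s - (meet x x').card) : ℝ) ≤ 𝒜.card / 2 ^ (s + 1) := by
      gcongr
      · norm_num
      · omega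
    rw [pow_succ, ← div_div] at h1
    linarith

/-- Choose the set I of meeting positions (at most 2^s ways); entries in I have s possible values
and the remaining at most s - r entries have n. -/
theorem card_filter_meet_ge (x : Fin s ↪ Fin n) {r : ℕ} (hs : 1 ≤ s) (hn : 1 ≤ n) :
    (univ.filter fun x' : Fin s ↪ Fin n => r ≤ (meet x x').card).card ≤
      2 ^ s * (s ^ s * n ^ (s - r)) := by
  classical
  let B : Finset (Fin s) → Finset (Fin s → Fin n) := fun I =>
    Fintype.piFinset fun i => if i ∈ I then univ.image x else univ
  have hB : ∀ I, r ≤ I.card → (B I).card ≤ s ^ s * n ^ (s - r) := by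
    intro I hI
    have hIs : I.card ≤ s := by simpa using Finset.card_le_univ I
    have : (B I).card = s ^ I.card * n ^ (s - I.card) := by
      have hp : ∀ i, (if i ∈ I then univ.image x else (univ : Finset (Fin n))).card =
          if i ∈ I then s else n := by
        intro i
        split_ifs
        · rw [Finset.card_image_of_injective _ x.injective]; simp
        · simp
      simp only [B, Fintype.card_piFinset, hp, Finset.prod_ite, Finset.prod_const]
      congr 2
      · simp
      · rw [Finset.filter_not, Finset.card_sdiff_of_subset (by simp)]; simp
    rw [this]
    exact Nat.mul_le_mul (Nat.pow_le_pow_right hs hIs) (Nat.pow_le_pow_right hn (by omega))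
  calc (univ.filter fun x' : Fin s ↪ Fin n => r ≤ (meet x x').card).card
      ≤ ((univ.filter fun I : Finset (Fin s) => r ≤ I.card).biUnion B).card := by
        refine Finset.card_le_card_of_injOn (fun x' => ⇑x') ?_ (DFunLike.coe_injective.injOn)
        intro x' hx'
        simp only [Finset.coe_filter, Finset.mem_univ, true_and, Set.mem_ofPred_eq] at hx'
        simp only [Finset.coe_biUnion, Set.mem_iUnion, Finset.mem_coe]
        refine ⟨meet x x', by simpa using hx', ?_⟩
        simp only [B, Fintype.mem_piFinset]
        intro i
        split_ifs with hi
        · simpa [meet] using hi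
        · simp
    _ ≤ ∑ I ∈ univ.filter fun I : Finset (Fin s) => r ≤ I.card, (B I).card :=
        Finset.card_biUnion_le
    _ ≤ ∑ _I ∈ univ.filter fun I : Finset (Fin s) => r ≤ I.card, s ^ s * n ^ (s - r) :=
        Finset.sum_le_sum fun I hI => hB I (by simpa using hI)
    _ ≤ 2 ^ s * (s ^ s * n ^ (s - r)) := by
        rw [Finset.sum_const, smul_eq_mul]
        gcongr
        exact (Finset.card_le_univ _).trans (by simp)

/-- Such a tuple is `x` composed with a permutation of the positions. -/
theorem card_filter_meet_eq (x : Fin s ↪ Fin n) :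
    (univ.filter fun x' : Fin s ↪ Fin n => (meet x x').card = s).card ≤ s.factorial := by
  classical
  have hx : ∀ x' : {x' : Fin s ↪ Fin n // (meet x x').card = s}, ∀ i, ∃ l, x l = x'.1 i := by
    intro x' i
    have : meet x x'.1 = univ := Finset.eq_univ_of_card _ (by simpa using x'.2)
    have hi : i ∈ meet x x'.1 := by simp [this]
    simpa [meet] using hi
  choose f hf using hx
  rw [← Nat.descFactorial_self, ← card_embedding_fin s s, ← Fintype.card_subtype]
  refine Fintype.card_le_of_injective (fun x' => (⟨f x', fun i j hij => ?_⟩ : Fin s ↪ Fin s)) ?_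
  · exact x'.1.injective (by rw [← hf, ← hf, hij])
  · intro a b hab
    refine Subtype.ext (DFunLike.ext _ _ fun i => ?_)
    have : f a i = f b i := DFunLike.congr_fun hab i
    rw [← hf, ← hf, this]

/-- The second moment of the number of avoiding tuples. -/
theorem sum_sum_uprob_avoids_le {𝒜 : Finset (Set (Fin s))} {r : ℕ} (h𝒜 : Separated 𝒜 r)
    (hs : 1 ≤ s) (hn : 1 ≤ n) (hq : (𝒜.card : ℝ) / 2 ^ s ≤ 1 / 2) :
    ∑ x : Fin s ↪ Fin n, ∑ x' : Fin s ↪ Fin n,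
        uprob (fun G : SimpleGraph (Fin n) => Avoids G 𝒜 x ∧ Avoids G 𝒜 x') ≤
      n.descFactorial s * (n.descFactorial s *
          ((1 - 𝒜.card / 2 ^ s) ^ 2 + 𝒜.card ^ 2 / 2 ^ (2 * s - r) : ℝ) ^ (n - 2 * s) +
        2 ^ s * (s ^ s * n ^ (s - r)) * (1 - 3 / 2 * (𝒜.card / 2 ^ s) : ℝ) ^ (n - 2 * s) +
        s.factorial * (1 - 𝒜.card / 2 ^ s : ℝ) ^ (n - s)) := by
  classical
  set R₁ := ((1 - 𝒜.card / 2 ^ s) ^ 2 + 𝒜.card ^ 2 / 2 ^ (2 * s - r) : ℝ) ^ (n - 2 * s)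
  set R₂ := (1 - 3 / 2 * (𝒜.card / 2 ^ s) : ℝ) ^ (n - 2 * s)
  set R₃ := (1 - 𝒜.card / 2 ^ s : ℝ) ^ (n - s)
  have hR₁ : 0 ≤ R₁ := by positivity
  have hR₂ : 0 ≤ R₂ := pow_nonneg (by linarith) _
  have hR₃ : 0 ≤ R₃ := pow_nonneg (by linarith) _
  have hx : ∀ x : Fin s ↪ Fin n, ∑ x' : Fin s ↪ Fin n,
      uprob (fun G : SimpleGraph (Fin n) => Avoids G 𝒜 x ∧ Avoids G 𝒜 x') ≤
      n.descFactorial s * R₁ + 2 ^ s * (s ^ s * n ^ (s - r)) * R₂ + s.factorial * R₃ := by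
    intro x
    calc ∑ x' : Fin s ↪ Fin n,
          uprob (fun G : SimpleGraph (Fin n) => Avoids G 𝒜 x ∧ Avoids G 𝒜 x')
        ≤ ∑ x' : Fin s ↪ Fin n, (R₁ + (if r ≤ (meet x x').card then R₂ else 0) +
            (if (meet x x').card = s then R₃ else 0)) := by
          refine Finset.sum_le_sum fun x' _ => ?_
          have hms : (meet x x').card ≤ s := by simpa using Finset.card_le_univ (meet x x')
          -- Three regimes: small overlap, large but incomplete overlap, and equal ranges, where the
          -- second event is simply dropped.
          rcases lt_or_ge (meet x x').card r with hlt | hge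
          · have := uprob_avoids_and_avoids_le_of_card_meet_le (𝒜 := 𝒜) hlt.le
            rw [if_neg (by omega)]
            split_ifs <;> linarith
          · rcases hms.lt_or_eq with hlt | heq
            · have := uprob_avoids_and_avoids_le_of_separated h𝒜 hge hlt
              rw [if_pos hge, if_neg hlt.ne]
              linarith
            · have : uprob (fun G : SimpleGraph (Fin n) => Avoids G 𝒜 x ∧ Avoids G 𝒜 x') ≤ R₃ :=
                (uprob_mono fun G hG => hG.1).trans (uprob_avoids 𝒜 x).le
              rw [if_pos hge, if_pos heq]
              linarith
      _ = n.descFactorial s * R₁ +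
          (univ.filter fun x' : Fin s ↪ Fin n => r ≤ (meet x x').card).card * R₂ +
          (univ.filter fun x' : Fin s ↪ Fin n => (meet x x').card = s).card * R₃ := by
          rw [Finset.sum_add_distrib, Finset.sum_add_distrib, ← Finset.sum_filter,
            ← Finset.sum_filter]
          simp only [Finset.sum_const, nsmul_eq_mul, Finset.card_univ, card_embedding_fin]
      _ ≤ _ := by
          gcongr
          · exact_mod_cast card_filter_meet_ge x hs hn
          · exact card_filter_meet_eq x
  refine (Finset.sum_le_sum fun x _ => hx x).trans ?_
  rw [Finset.sum_const, Finset.card_univ, card_embedding_fin, nsmul_eq_mul]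

/-- Lower bound for the probability that there is an avoiding tuple. -/
theorem one_le_uprob_exists_avoids_mul {𝒜 : Finset (Set (Fin s))} {r : ℕ} (h𝒜 : Separated 𝒜 r)
    (hs : 1 ≤ s) (hsn : s ≤ n) (hq : (𝒜.card : ℝ) / 2 ^ s ≤ 1 / 2) :
    1 ≤ uprob (fun G : SimpleGraph (Fin n) => ∃ x : Fin s ↪ Fin n, Avoids G 𝒜 x) *
      (((1 - 𝒜.card / 2 ^ s) ^ 2 + 𝒜.card ^ 2 / 2 ^ (2 * s - r) : ℝ) ^ (n - 2 * s) /
          ((1 - 𝒜.card / 2 ^ s) ^ 2) ^ (n - s) +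
        2 ^ s * (s ^ s * n ^ (s - r)) * (1 - 3 / 2 * (𝒜.card / 2 ^ s) : ℝ) ^ (n - 2 * s) /
          (n.descFactorial s * ((1 - 𝒜.card / 2 ^ s) ^ 2) ^ (n - s)) +
        s.factorial / (n.descFactorial s * (1 - 𝒜.card / 2 ^ s : ℝ) ^ (n - s))) := by
  have h1 := sq_sum_uprob_le fun (x : Fin s ↪ Fin n) (G : SimpleGraph (Fin n)) => Avoids G 𝒜 x
  simp only [uprob_avoids, Finset.sum_const, Finset.card_univ, card_embedding_fin,
    nsmul_eq_mul] at h1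
  have h2 := sum_sum_uprob_avoids_le (n := n) h𝒜 hs (by omega) hq
  have h3 := h1.trans (mul_le_mul_of_nonneg_left h2 (uprob_nonneg _))
  have hD : (0 : ℝ) < n.descFactorial s := by exact_mod_cast Nat.descFactorial_pos.2 hsn
  have hQ : (0 : ℝ) < (1 - 𝒜.card / 2 ^ s) ^ (n - s) := pow_pos (by linarith) _
  rw [pow_right_comm _ 2 (n - s)]
  generalize (1 - 𝒜.card / 2 ^ s : ℝ) ^ (n - s) = Q at *
  generalize (n.descFactorial s : ℝ) = D at *
  have hDQ : 0 < (D * Q) ^ 2 := by positivity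
  rw [← one_le_div hDQ] at h3
  refine h3.trans_eq ?_
  field_simp

end Moments

end RandomGraphLogic

namespace RandomGraphLogic

open Real Filter Topology

/-! ### The function `fExt` -/

section FExt

/-- The logarithm of the denominator of the binomial coefficient. -/
noncomputable def logGammaPair (n : ℕ) (x : ℝ) : ℝ :=
  log (Gamma (x + 1)) + log (Gamma ((n : ℝ) - x + 1))

theorem logGammaPair_symm (n : ℕ) (x : ℝ) : logGammaPair n ((n : ℝ) - x) = logGammaPair n x := by
  simp [logGammaPair, add_comm]

theorem convexOn_logGammaPair (n : ℕ) : ConvexOn ℝ (Set.Icc (0 : ℝ) n) (logGammaPair n) := by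
  have h1 : ConvexOn ℝ (Set.Icc (0 : ℝ) n) fun x : ℝ => log (Gamma (x + 1)) := by
    have := convexOn_log_Gamma.comp_affineMap (AffineMap.id ℝ ℝ + AffineMap.const ℝ ℝ (1 : ℝ))
    refine (this.subset (fun x hx => ?_) (convex_Icc _ _)).congr fun x _ => by simp
    simp only [Set.mem_preimage, AffineMap.coe_add, AffineMap.coe_id, AffineMap.coe_const,
      Pi.add_apply, id, Function.const_apply, Set.mem_Ioi]
    linarith [hx.1]
  have h2 : ConvexOn ℝ (Set.Icc (0 : ℝ) n) fun x : ℝ => log (Gamma ((n : ℝ) - x + 1)) := by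
    have := convexOn_log_Gamma.comp_affineMap
      (AffineMap.const ℝ ℝ ((n : ℝ) + 1) - AffineMap.id ℝ ℝ)
    refine (this.subset (fun x hx => ?_) (convex_Icc _ _)).congr fun x _ => by
      simp [sub_add_eq_add_sub]
    simp only [Set.mem_preimage, AffineMap.coe_sub, AffineMap.coe_id, AffineMap.coe_const,
      Pi.sub_apply, id, Function.const_apply, Set.mem_Ioi]
    linarith [hx.2]
  exact h1.add h2

/-- A convex function on [0, n] symmetric about n/2 is, on [x, n - x], bounded by its common value
at the two ends. For real x this replaces the unimodality of binomial coefficients. -/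
theorem logGammaPair_le {n : ℕ} {x y : ℝ} (hx : 0 ≤ x) (hxy : x ≤ y) (hy : y ≤ n - x) :
    logGammaPair n y ≤ logGammaPair n x := by
  have h := (convexOn_logGammaPair n).le_max_of_mem_Icc (x := x) (y := n - x) (z := y)
    ⟨hx, by linarith⟩ ⟨by linarith, by linarith⟩ ⟨hxy, hy⟩
  rwa [logGammaPair_symm, max_self] at h

theorem one_sub_two_rpow_neg_pos {x : ℝ} (hx : 0 < x) : 0 < 1 - (2 : ℝ) ^ (-x) := by
  rw [sub_pos]
  exact rpow_lt_one_of_one_lt_of_neg (by norm_num) (by linarith)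

theorem fExt_eq {n : ℕ} {x : ℝ} (hx : 0 < x) (hxn : x ≤ n) :
    fExt n x = log (Gamma (n + 1)) - logGammaPair n x + x * log 2 +
      (n - x) * log (1 - (2 : ℝ) ^ (-x)) := by
  have h1 : 0 < Gamma ((n : ℝ) + 1) := Gamma_pos_of_pos (by positivity)
  have h2 : 0 < Gamma (x + 1) := Gamma_pos_of_pos (by positivity)
  have h3 : 0 < Gamma ((n : ℝ) - x + 1) := Gamma_pos_of_pos (by linarith)
  have h4 := one_sub_two_rpow_neg_pos hx
  rw [fExt, log_mul (by positivity) (by positivity), log_mul (by positivity) (by positivity),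
    log_div (by positivity) (by positivity), log_mul (by positivity) (by positivity),
    log_rpow h4, log_rpow (by norm_num), logGammaPair]

theorem fExt_natCast {n m : ℕ} (hmn : m ≤ n) :
    fExt n m = log (n.choose m * 2 ^ m * (1 - 1 / 2 ^ m) ^ (n - m)) := by
  rw [fExt, Gamma_nat_eq_factorial, Gamma_nat_eq_factorial, ← Nat.cast_sub hmn,
    Gamma_nat_eq_factorial, rpow_natCast, rpow_natCast, rpow_neg (by norm_num), rpow_natCast,
    Nat.cast_choose ℝ hmn, one_div]

/-- Left of n/2 each of the three terms is monotone: the binomial coefficient does not decrease, x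
ln 2 strictly increases, and in (n - x) ln(1 - 2^(-x)) both factors shrink in absolute value. -/
theorem fExt_lt_fExt {n : ℕ} {x y : ℝ} (hx : 0 < x) (hxy : x < y) (hy : y ≤ n / 2) :
    fExt n x < fExt n y := by
  rw [fExt_eq hx (by linarith), fExt_eq (hx.trans hxy) (by linarith)]
  have h1 : logGammaPair n y ≤ logGammaPair n x := logGammaPair_le hx.le hxy.le (by linarith)
  have h2 : x * log 2 < y * log 2 := mul_lt_mul_of_pos_right hxy (log_pos (by norm_num))
  have h3 : log (1 - (2 : ℝ) ^ (-x)) ≤ log (1 - (2 : ℝ) ^ (-y)) := by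
    apply log_le_log (one_sub_two_rpow_neg_pos hx)
    gcongr
    · norm_num
  have h4 : log (1 - (2 : ℝ) ^ (-y)) ≤ 0 :=
    log_nonpos (one_sub_two_rpow_neg_pos (hx.trans hxy)).le (by
      have : (0 : ℝ) < 2 ^ (-y) := by positivity
      linarith)
  nlinarith

theorem neg_div_le_log_one_sub {u : ℝ} (hu : u < 1) : -(u / (1 - u)) ≤ log (1 - u) := by
  have h := one_sub_inv_le_log_of_pos (sub_pos.2 hu)
  refine le_trans (le_of_eq ?_) h
  have : 1 - u ≠ 0 := (sub_pos.2 hu).ne'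
  field_simp
  ring

/-- The binomial coefficient is at least 1, and x ln 2 outweighs the last term, which is at least
-x/3 because n - x ≤ x and 2^(-x) ≤ 1/4. Hence all roots lie left of n/2, where the function is
strictly increasing. -/
theorem fExt_pos {n : ℕ} (hn : 4 ≤ n) {x : ℝ} (hx : (n : ℝ) / 2 ≤ x) (hxn : x ≤ n) :
    0 < fExt n x := by
  have hn' : (4 : ℝ) ≤ n := by exact_mod_cast hn
  have hx2 : 2 ≤ x := by linarith
  rw [fExt_eq (by linarith) hxn]
  have h1 : logGammaPair n x ≤ log (Gamma (n + 1)) := by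
    have := logGammaPair_le (n := n) le_rfl (by linarith : (0 : ℝ) ≤ x) (by linarith)
    simpa [logGammaPair] using this
  have hu : (2 : ℝ) ^ (-x) ≤ 1 / 4 := by
    calc (2 : ℝ) ^ (-x) ≤ (2 : ℝ) ^ (-2 : ℝ) := by gcongr; norm_num
      _ = 1 / 4 := by
        rw [rpow_neg (by norm_num)]; norm_num
  have hu0 : (0 : ℝ) < 2 ^ (-x) := by positivity
  have h2 := neg_div_le_log_one_sub (by linarith : (2 : ℝ) ^ (-x) < 1)
  have h3 : (2 : ℝ) ^ (-x) / (1 - 2 ^ (-x)) ≤ 1 / 3 := by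
    rw [div_le_div_iff₀ (by linarith) (by norm_num)]; linarith
  have h4 : -(1 / 3) * x ≤ (n - x) * log (1 - (2 : ℝ) ^ (-x)) := by
    have : (n - x) * (-(1 / 3)) ≤ (n - x) * log (1 - (2 : ℝ) ^ (-x)) :=
      mul_le_mul_of_nonneg_left (by linarith) (by linarith)
    nlinarith
  have h5 := log_two_gt_d9
  nlinarith

theorem exists_fExt_eq_zero {n : ℕ} (hn : 6 ≤ n) : ∃ x ∈ Set.Icc (1 : ℝ) n, fExt n x = 0 := by
  have hn' : (6 : ℝ) ≤ n := by exact_mod_cast hn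
  have hcont : ContinuousOn (fExt n) (Set.Icc (1 : ℝ) n) := by
    have hG : ∀ y : ℝ, 0 < y → ContinuousAt Gamma y := fun y hy =>
      (differentiableAt_Gamma fun m => by have : (0 : ℝ) ≤ m := by positivity
                                          linarith).continuousAt
    intro x hx
    have hx0 : (0 : ℝ) < x := by linarith [hx.1]
    have h1 : 0 < Gamma ((n : ℝ) + 1) := Gamma_pos_of_pos (by positivity)
    have h2 : 0 < Gamma (x + 1) := Gamma_pos_of_pos (by positivity)
    have h3 : 0 < Gamma ((n : ℝ) - x + 1) := Gamma_pos_of_pos (by linarith [hx.2])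
    have h4 := one_sub_two_rpow_neg_pos hx0
    have c1 : ContinuousAt (fun x : ℝ => Gamma (x + 1)) x :=
      ContinuousAt.comp (f := fun x : ℝ => x + 1) (hG _ (by linarith)) (by fun_prop)
    have c2 : ContinuousAt (fun x : ℝ => Gamma ((n : ℝ) - x + 1)) x :=
      ContinuousAt.comp (f := fun x : ℝ => (n : ℝ) - x + 1) (hG _ (by linarith [hx.2]))
        (by fun_prop)
    have c3 : ContinuousAt (fun x : ℝ => (2 : ℝ) ^ x) x :=
      continuousAt_const.rpow continuousAt_id (Or.inl (by norm_num))
    have c4 : ContinuousAt (fun x : ℝ => 1 - (2 : ℝ) ^ (-x)) x :=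
      continuousAt_const.sub (continuousAt_const.rpow continuousAt_id.neg (Or.inl (by norm_num)))
    have c5 : ContinuousAt (fun x : ℝ => (1 - (2 : ℝ) ^ (-x)) ^ ((n : ℝ) - x)) x :=
      c4.rpow (by fun_prop) (Or.inl h4.ne')
    refine (ContinuousAt.log (((continuousAt_const.div (c1.mul c2) (mul_pos h2 h3).ne').mul c3).mul c5)
      ?_).continuousWithinAt
    exact (mul_pos (mul_pos (div_pos h1 (mul_pos h2 h3)) (rpow_pos_of_pos two_pos x))
      (rpow_pos_of_pos h4 _)).ne'
  have h1 : fExt n 1 ≤ 0 := by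
    have := fExt_natCast (n := n) (m := 1) (by omega)
    rw [Nat.cast_one] at this
    rw [this]
    -- At x = 1 the claim is 2n ≤ 2^(n-1), which holds from n = 6 on; this explains the hypothesis
    -- on `n`.
    have hpow : ∀ m : ℕ, 5 ≤ m → (m + 1) * 2 ≤ 2 ^ m := by
      intro m hm
      induction m, hm using Nat.le_induction with
      | base => norm_num
      | succ m hm ih => rw [pow_succ]; omega
    have h := hpow (n - 1) (by omega)
    refine log_nonpos (by norm_num) ?_
    have h' : ((n : ℝ) * 2) ≤ 2 ^ (n - 1) := by
      rw [show n - 1 + 1 = n by omega] at h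
      exact_mod_cast h
    norm_num
    rw [← le_div_iff₀ (by positivity)]
    simpa using h'
  have h2 : 0 ≤ fExt n n := (fExt_pos (by omega) (by linarith) le_rfl).le
  obtain ⟨x, hx, hx0⟩ := intermediate_value_Icc (by linarith) hcont ⟨h1, h2⟩
  exact ⟨x, hx, hx0⟩

theorem lt_of_fExt_pos {n : ℕ} (hn : 4 ≤ n) {x y : ℝ} (hx1 : 1 ≤ x) (hy1 : 0 < y)
    (hxn : x ≤ n) (h : fExt n x = 0) (hfy : 0 < fExt n y) : x < y := by
  have hx2 : x < n / 2 := by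
    by_contra! hge
    exact (fExt_pos hn hge hxn).ne' h
  by_contra! hyx
  rcases hyx.eq_or_lt with rfl | hlt
  · linarith
  · linarith [fExt_lt_fExt hy1 hlt hx2.le]

theorem lt_of_fExt_neg {n : ℕ} {x y : ℝ} (hx1 : 1 ≤ x) (hy : y ≤ n / 2)
    (h : fExt n x = 0) (hfy : fExt n y < 0) : y < x := by
  by_contra! hyx
  rcases hyx.eq_or_lt with rfl | hlt
  · linarith
  · linarith [fExt_lt_fExt (by linarith) hlt hy]

theorem existsUnique_fExt_eq_zero {n : ℕ} (hn : 6 ≤ n) :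
    ∃! x : ℝ, x ∈ Set.Icc (1 : ℝ) n ∧ fExt n x = 0 := by
  obtain ⟨x, hx, hx0⟩ := exists_fExt_eq_zero hn
  have key : ∀ y z : ℝ, y ∈ Set.Icc (1 : ℝ) n ∧ fExt n y = 0 → z ∈ Set.Icc (1 : ℝ) n ∧ fExt n z = 0 →
      ¬ y < z := by
    rintro y z ⟨hy, hy0⟩ ⟨hz, hz0⟩ hyz
    have hz2 : z ≤ n / 2 := by
      by_contra! hgt
      exact (fExt_pos (by omega) hgt.le hz.2).ne' hz0
    linarith [fExt_lt_fExt (by linarith [hy.1]) hyz hz2]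
  exact ⟨x, ⟨hx, hx0⟩, fun y hy => le_antisymm (not_lt.1 (key x y ⟨hx, hx0⟩ hy))
    (not_lt.1 (key y x hy ⟨hx, hx0⟩))⟩

/-! ### The location of the root -/

theorem log_Gamma_sub_logGammaPair_natCast {n m : ℕ} (hmn : m ≤ n) :
    log (Gamma (n + 1)) - logGammaPair n m = log (n.choose m) := by
  have h1 := Nat.factorial_pos m
  have h2 := Nat.factorial_pos (n - m)
  rw [logGammaPair, Gamma_nat_eq_factorial, Gamma_nat_eq_factorial, ← Nat.cast_sub hmn,
    Gamma_nat_eq_factorial, Nat.cast_choose ℝ hmn, log_div (by positivity) (by positivity),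
    log_mul (by positivity) (by positivity)]

/-- Rounding x up to an integer inside the binomial factor costs at most one factor n, negligible on
the scale exp((ln n)²). -/
theorem fExt_le {n : ℕ} {x : ℝ} (hx : 0 < x) (hxn : x + 1 ≤ n / 2) :
    fExt n x ≤ (x + 1) * log n + x - (n - x) * 2 ^ (-x) := by
  have hn : (1 : ℝ) ≤ n := by linarith
  have hc1 := Nat.le_ceil x
  have hc2 := Nat.ceil_lt_add_one hx.le
  rw [fExt_eq hx (by linarith)]
  have h1 : log (Gamma (n + 1)) - logGammaPair n x ≤ (x + 1) * log n := by
    have := logGammaPair_le (n := n) hx.le hc1 (by linarith)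
    have hle : ⌈x⌉₊ ≤ n := by
      have : (⌈x⌉₊ : ℝ) ≤ n := by linarith
      exact_mod_cast this
    calc log (Gamma (n + 1)) - logGammaPair n x ≤ log (Gamma (n + 1)) - logGammaPair n ⌈x⌉₊ := by
          linarith
      _ = log (n.choose ⌈x⌉₊) := log_Gamma_sub_logGammaPair_natCast hle
      _ ≤ log ((n : ℝ) ^ ⌈x⌉₊) := by
          apply log_le_log
          · exact_mod_cast Nat.choose_pos hle
          · exact_mod_cast Nat.choose_le_pow n _
      _ = ⌈x⌉₊ * log n := log_pow _ _
      _ ≤ (x + 1) * log n := by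
          have := log_nonneg hn
          gcongr
  have h2 : log (1 - (2 : ℝ) ^ (-x)) ≤ - 2 ^ (-x) := by
    have := log_le_sub_one_of_pos (one_sub_two_rpow_neg_pos hx)
    linarith
  have h3 : x * log 2 ≤ x := by
    have := log_two_lt_d9
    nlinarith
  have h4 : (n - x) * log (1 - (2 : ℝ) ^ (-x)) ≤ (n - x) * (- 2 ^ (-x)) :=
    mul_le_mul_of_nonneg_left h2 (by linarith)
  linarith

/-- A lower bound for binomial coefficients. -/
theorem mul_log_le_log_choose {n m : ℕ} (hm : 1 ≤ m) (hmn : 2 * m ≤ n) :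
    m * (log n - log (2 * m)) ≤ log (n.choose m) := by
  have hm' : (0 : ℝ) < m := by exact_mod_cast hm
  have hn' : (0 : ℝ) < n := by exact_mod_cast (by omega : 0 < n)
  rw [← log_div (by positivity) (by positivity), ← log_pow]
  apply log_le_log (by positivity)
  have h1 : ((n + 1 - m : ℕ) ^ m : ℝ) / m.factorial ≤ n.choose m := Nat.pow_le_choose m n
  refine le_trans ?_ h1
  have h2 : (m.factorial : ℝ) ≤ (m : ℝ) ^ m := by exact_mod_cast Nat.factorial_le_pow m
  have h3 : (n : ℝ) / 2 ≤ (n + 1 - m : ℕ) := by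
    have : (n : ℝ) ≤ ((2 * (n + 1 - m) : ℕ) : ℝ) := by exact_mod_cast (by omega)
    push_cast at this
    linarith
  calc ((n : ℝ) / (2 * m)) ^ m = (n / 2) ^ m / (m : ℝ) ^ m := by rw [← div_pow, div_div]
    _ ≤ ((n + 1 - m : ℕ) : ℝ) ^ m / m.factorial := by
      gcongr

/-- Companion bound: here x is rounded down, and log(1 - u) ≥ -u/(1 - u) controls the last term. -/
theorem le_fExt {n : ℕ} {x : ℝ} (hx : 1 ≤ x) (hxn : x ≤ n / 2) :
    (x - 1) * (log n - log (2 * x)) - n * 2 ^ (-x) / (1 - 2 ^ (-x)) ≤ fExt n x := by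
  have hf1 := Nat.floor_le (by linarith : 0 ≤ x)
  have hf2 := Nat.lt_floor_add_one x
  have hf : 1 ≤ ⌊x⌋₊ := Nat.one_le_floor_iff x |>.2 hx
  have hf' : (1 : ℝ) ≤ ⌊x⌋₊ := by exact_mod_cast hf
  have hu := one_sub_two_rpow_neg_pos (by linarith : 0 < x)
  rw [fExt_eq (by linarith) (by linarith)]
  have h2f : 2 * ⌊x⌋₊ ≤ n := by
    have : ((2 * ⌊x⌋₊ : ℕ) : ℝ) ≤ n := by push_cast; linarith
    exact_mod_cast this
  have hlog : 0 ≤ log n - log (2 * x) := by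
    rw [sub_nonneg]
    exact log_le_log (by linarith) (by linarith)
  have h1 : (x - 1) * (log n - log (2 * x)) ≤ log (Gamma (n + 1)) - logGammaPair n x := by
    calc (x - 1) * (log n - log (2 * x)) ≤ ⌊x⌋₊ * (log n - log (2 * ⌊x⌋₊)) := by
          gcongr
          linarith
      _ ≤ log (n.choose ⌊x⌋₊) := mul_log_le_log_choose hf h2f
      _ = log (Gamma (n + 1)) - logGammaPair n ⌊x⌋₊ :=
          (log_Gamma_sub_logGammaPair_natCast (by omega)).symm
      _ ≤ log (Gamma (n + 1)) - logGammaPair n x := by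
          have := logGammaPair_le (n := n) (by positivity) hf1 (by linarith)
          linarith
  have h2 := neg_div_le_log_one_sub (by linarith : (2 : ℝ) ^ (-x) < 1)
  have h3 : (0 : ℝ) ≤ 2 ^ (-x) / (1 - 2 ^ (-x)) := by positivity
  have h4 : -(n * (2 ^ (-x) / (1 - 2 ^ (-x)))) ≤ (n - x) * log (1 - (2 : ℝ) ^ (-x)) := by
    have : (n - x) * (-(2 ^ (-x) / (1 - 2 ^ (-x)))) ≤ (n - x) * log (1 - (2 : ℝ) ^ (-x)) :=
      mul_le_mul_of_nonneg_left h2 (by linarith)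
    nlinarith
  have h5 : 0 ≤ x * log 2 := mul_nonneg (by linarith) (log_nonneg (by norm_num))
  rw [mul_div_assoc]
  linarith

end FExt

end RandomGraphLogic

namespace RandomGraphLogic

open Real Filter Topology

/-! ### Asymptotics of the root -/

section Asymptotics

theorem tendsto_log_nat : Tendsto (fun n : ℕ => log (n : ℝ)) atTop atTop :=
  tendsto_log_atTop.comp tendsto_natCast_atTop_atTop

theorem tendsto_const_div_log (a : ℝ) : Tendsto (fun n : ℕ => a / log (n : ℝ)) atTop (𝓝 0) :=
  tendsto_log_nat.const_div_atTop a

theorem tendsto_loglog_div_log :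
    Tendsto (fun n : ℕ => log (log (n : ℝ)) / log (n : ℝ)) atTop (𝓝 0) :=
  isLittleO_log_id_atTop.tendsto_div_nhds_zero.comp tendsto_log_nat

theorem tendsto_log_pow_div_nat (k : ℕ) :
    Tendsto (fun n : ℕ => log (n : ℝ) ^ k / (n : ℝ)) atTop (𝓝 0) :=
  (isLittleO_pow_log_id_atTop (n := k)).tendsto_div_nhds_zero.comp tendsto_natCast_atTop_atTop

theorem eventually_log_pos : ∀ᶠ n : ℕ in atTop, 0 < log (n : ℝ) :=
  tendsto_log_nat.eventually_gt_atTop 0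

theorem tendsto_exp_of_div_log {g : ℕ → ℝ} {L : ℝ} (hL : L < 0)
    (h : Tendsto (fun n : ℕ => g n / log (n : ℝ)) atTop (𝓝 L)) :
    Tendsto (fun n => exp (g n)) atTop (𝓝 0) := by
  refine tendsto_exp_atBot.comp ?_
  refine (h.neg_mul_atTop hL tendsto_log_nat).congr' ?_
  filter_upwards [eventually_log_pos] with n hn
  field_simp

theorem tendsto_exp_of_div_sq_log {g : ℕ → ℝ} {L : ℝ} (hL : L < 0)
    (h : Tendsto (fun n : ℕ => g n / log (n : ℝ) ^ 2) atTop (𝓝 L)) :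
    Tendsto (fun n => exp (g n)) atTop (𝓝 0) := by
  refine tendsto_exp_atBot.comp ?_
  refine (h.neg_mul_atTop hL ((tendsto_pow_atTop two_ne_zero).comp tendsto_log_nat)).congr' ?_
  filter_upwards [eventually_log_pos] with n hn
  simp only [Function.comp_apply]
  field_simp

theorem eventually_neg_of_div_sq_log {g : ℕ → ℝ} {L : ℝ} (hL : L < 0)
    (h : Tendsto (fun n : ℕ => g n / log (n : ℝ) ^ 2) atTop (𝓝 L)) : ∀ᶠ n in atTop, g n < 0 := by
  filter_upwards [h.eventually_lt_const hL, eventually_log_pos] with n hn hpos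
  rwa [div_lt_iff₀ (by positivity), zero_mul] at hn

/-! ### Sequences of order ln n -/

section LogGrowth

variable {x : ℕ → ℝ} {a : ℝ}

theorem tendsto_div_nat_of_div_log (h : Tendsto (fun n : ℕ => x n / log (n : ℝ)) atTop (𝓝 a)) :
    Tendsto (fun n : ℕ => x n / (n : ℝ)) atTop (𝓝 0) := by
  have h1 := h.mul (tendsto_log_pow_div_nat 1)
  rw [mul_zero] at h1
  refine h1.congr' ?_
  filter_upwards [eventually_log_pos] with n hn
  field_simp

theorem tendsto_atTop_of_div_log (ha : 0 < a)
    (h : Tendsto (fun n : ℕ => x n / log (n : ℝ)) atTop (𝓝 a)) : Tendsto x atTop atTop := by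
  refine (h.pos_mul_atTop ha tendsto_log_nat).congr' ?_
  filter_upwards [eventually_log_pos] with n hn
  field_simp

theorem tendsto_log_div_log_of_div_log (ha : 0 < a)
    (h : Tendsto (fun n : ℕ => x n / log (n : ℝ)) atTop (𝓝 a)) :
    Tendsto (fun n : ℕ => log (x n) / log (n : ℝ)) atTop (𝓝 0) := by
  have h1 : Tendsto (fun n : ℕ => log (x n / log (n : ℝ)) / log (n : ℝ)) atTop (𝓝 0) :=
    (h.log ha.ne').div_atTop tendsto_log_nat
  have h2 := h1.add tendsto_loglog_div_log
  rw [zero_add] at h2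
  refine h2.congr' ?_
  filter_upwards [eventually_log_pos, (tendsto_atTop_of_div_log ha h).eventually_gt_atTop 0]
    with n hn hx
  rw [log_div hx.ne' hn.ne']
  ring

theorem tendsto_div_sq_log_of_div_log
    (h : Tendsto (fun n : ℕ => x n / log (n : ℝ)) atTop (𝓝 a)) :
    Tendsto (fun n : ℕ => x n / log (n : ℝ) ^ 2) atTop (𝓝 0) := by
  refine (h.div_atTop tendsto_log_nat).congr fun n => ?_
  rw [div_div, sq]

theorem eventually_le_mul_nat_of_div_log {ε : ℝ} (hε : 0 < ε)
    (h : Tendsto (fun n : ℕ => x n / log (n : ℝ)) atTop (𝓝 a)) :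
    ∀ᶠ n : ℕ in atTop, x n ≤ ε * n := by
  filter_upwards [(tendsto_div_nat_of_div_log h).eventually_lt_const hε, eventually_gt_atTop 0]
    with n hn hpos
  have : (0 : ℝ) < n := by exact_mod_cast hpos
  rw [div_lt_iff₀ this] at hn
  exact hn.le

end LogGrowth

/-- The number `x` with `2 ^ (-x) = κ (ln n) ^ 2 / (n ln 2)`. -/
noncomputable def rootApprox (κ : ℝ) (n : ℕ) : ℝ :=
  (log n - 2 * log (log n) + log (log 2) - log κ) / log 2

theorem log_two_pos : 0 < log 2 := log_pos (by norm_num)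

theorem two_rpow_neg_rootApprox {κ : ℝ} (hκ : 0 < κ) {n : ℕ} (hn : 0 < log (n : ℝ)) :
    (2 : ℝ) ^ (-rootApprox κ n) = κ * (log n ^ 2 / log 2) / n := by
  have hn0 : (0 : ℝ) < n := by
    rcases Nat.eq_zero_or_pos n with rfl | h
    · simp at hn
    · exact_mod_cast h
  have h2 := log_two_pos
  rw [rpow_def_of_pos (by norm_num), rootApprox, mul_neg, mul_div_cancel₀ _ h2.ne',
    ← exp_log (show 0 < κ * (log n ^ 2 / log 2) / n by positivity)]
  congr 1
  rw [log_div (by positivity) hn0.ne', log_mul hκ.ne' (by positivity), log_div (by positivity)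
    h2.ne', log_pow]
  push_cast
  ring

theorem tendsto_rootApprox_div_log (κ : ℝ) :
    Tendsto (fun n : ℕ => rootApprox κ n / log (n : ℝ)) atTop (𝓝 (1 / log 2)) := by
  have h : Tendsto (fun n : ℕ => (1 - 2 * (log (log (n : ℝ)) / log (n : ℝ)) +
      (log (log 2) - log κ) / log (n : ℝ)) / log 2) atTop (𝓝 ((1 - 2 * 0 + 0) / log 2)) :=
    ((tendsto_const_nhds.sub (tendsto_loglog_div_log.const_mul 2)).add
      (tendsto_const_div_log _)).div_const _
  rw [mul_zero, sub_zero, add_zero] at h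
  refine h.congr' ?_
  filter_upwards [eventually_log_pos] with n hn
  have h2 := log_two_pos
  rw [rootApprox]
  field_simp
  ring

/-- At this point the binomial factor contributes W = (ln n)²/ln 2 to leading order and the last
term contributes -κW, so the function is (1 - κ + o(1))W and its sign is that of 1 - κ. -/
theorem eventually_fExt_rootApprox_neg {κ : ℝ} (hκ : 1 < κ) :
    ∀ᶠ n : ℕ in atTop, fExt n (rootApprox κ n) < 0 := by
  have hc := log_two_pos
  have hx := tendsto_rootApprox_div_log κ
  have h1 : Tendsto (fun n : ℕ => ((rootApprox κ n + 1) * log n + rootApprox κ n -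
      (n - rootApprox κ n) * 2 ^ (-rootApprox κ n)) / log (n : ℝ) ^ 2) atTop
      (𝓝 (1 / log 2 + 0 + 0 - (1 - 0) * (κ / log 2))) := by
    refine Tendsto.congr' ?_ (((hx.add (tendsto_const_div_log 1)).add
      (tendsto_div_sq_log_of_div_log hx)).sub
      ((tendsto_const_nhds.sub (tendsto_div_nat_of_div_log hx)).mul_const (κ / log 2)))
    filter_upwards [eventually_log_pos, eventually_gt_atTop 0] with n hn hn0
    have : (0 : ℝ) < n := by exact_mod_cast hn0
    rw [two_rpow_neg_rootApprox (by linarith) hn]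
    field_simp
  have hneg : 1 / log 2 + 0 + 0 - (1 - 0) * (κ / log 2) < 0 := by
    have : 1 / log 2 < κ / log 2 := by gcongr
    linarith
  filter_upwards [eventually_neg_of_div_sq_log hneg h1,
    (tendsto_atTop_of_div_log (by positivity) hx).eventually_gt_atTop 0,
    eventually_le_mul_nat_of_div_log (ε := 1 / 4) (by norm_num) hx,
    tendsto_natCast_atTop_atTop.eventually_ge_atTop (4 : ℝ)] with n h1 h2 h3 h4
  exact (fExt_le h2 (by linarith)).trans_lt h1

theorem eventually_fExt_rootApprox_pos {κ : ℝ} (hκ0 : 0 < κ) (hκ : κ < 1) :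
    ∀ᶠ n : ℕ in atTop, 0 < fExt n (rootApprox κ n) := by
  have hc := log_two_pos
  have hx := tendsto_rootApprox_div_log κ
  have hx2 : Tendsto (fun n : ℕ => (2 * rootApprox κ n) / log (n : ℝ)) atTop
      (𝓝 (2 * (1 / log 2))) := (hx.const_mul 2).congr fun n => (mul_div_assoc _ _ _).symm
  have hu : Tendsto (fun n : ℕ => (2 : ℝ) ^ (-rootApprox κ n)) atTop (𝓝 0) := by
    have h := (tendsto_log_pow_div_nat 2).const_mul (κ / log 2)
    rw [mul_zero] at h
    refine h.congr' ?_
    filter_upwards [eventually_log_pos] with n hn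
    rw [two_rpow_neg_rootApprox hκ0 hn]
    field_simp
  have h1 : Tendsto (fun n : ℕ => (n * (2 : ℝ) ^ (-rootApprox κ n) /
      (1 - 2 ^ (-rootApprox κ n)) - (rootApprox κ n - 1) * (log n - log (2 * rootApprox κ n))) /
        log (n : ℝ) ^ 2) atTop
      (𝓝 (κ / log 2 / (1 - 0) - (1 / log 2 - 0) * (1 - 0))) := by
    refine Tendsto.congr' ?_ ((Tendsto.div (tendsto_const_nhds (x := κ / log 2))
      (tendsto_const_nhds.sub hu) (by norm_num)).sub ((hx.sub (tendsto_const_div_log 1)).mul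
        (tendsto_const_nhds.sub (tendsto_log_div_log_of_div_log (by positivity) hx2))))
    filter_upwards [eventually_log_pos, eventually_gt_atTop 0, hu.eventually_lt_const one_pos]
      with n hn hn0 hu1
    have hn0 : (0 : ℝ) < n := by exact_mod_cast hn0
    have hne : 1 - (2 : ℝ) ^ (-rootApprox κ n) ≠ 0 := by linarith
    have he : κ / log 2 = n * (2 : ℝ) ^ (-rootApprox κ n) / log n ^ 2 := by
      rw [two_rpow_neg_rootApprox hκ0 hn]
      field_simp
    rw [Pi.div_apply, he]
    field_simp
  have hneg : κ / log 2 / (1 - 0) - (1 / log 2 - 0) * (1 - 0) < 0 := by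
    have : κ / log 2 < 1 / log 2 := by gcongr
    linarith
  filter_upwards [eventually_neg_of_div_sq_log hneg h1,
    (tendsto_atTop_of_div_log (by positivity) hx).eventually_ge_atTop 1,
    eventually_le_mul_nat_of_div_log (ε := 1 / 2) (by norm_num) hx] with n h1 h2 h3
  have := le_fExt h2 (by linarith : rootApprox κ n ≤ n / 2)
  linarith

/-! ### Squeezing the root between explicit approximations -/

section Root

theorem eventually_rootApprox_lt {kHat : ℕ → ℝ} (hkHat : ∀ᶠ n : ℕ in atTop,
      kHat n ∈ Set.Icc (1 : ℝ) (n : ℝ) ∧ fExt n (kHat n) = 0)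
    {κ : ℝ} (hκ : 1 < κ) :
    ∀ᶠ n : ℕ in atTop, rootApprox κ n < kHat n := by
  filter_upwards [hkHat, eventually_fExt_rootApprox_neg hκ, eventually_le_mul_nat_of_div_log
    (ε := 1 / 2) (by norm_num) (tendsto_rootApprox_div_log κ)] with n h1 h2 h3
  exact lt_of_fExt_neg h1.1.1 (by linarith) h1.2 h2

theorem eventually_lt_rootApprox {kHat : ℕ → ℝ} (hkHat : ∀ᶠ n : ℕ in atTop,
      kHat n ∈ Set.Icc (1 : ℝ) (n : ℝ) ∧ fExt n (kHat n) = 0)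
    {κ : ℝ} (hκ0 : 0 < κ) (hκ : κ < 1) :
    ∀ᶠ n : ℕ in atTop, kHat n < rootApprox κ n := by
  filter_upwards [hkHat, eventually_fExt_rootApprox_pos hκ0 hκ, eventually_ge_atTop 4,
    (tendsto_atTop_of_div_log (one_div_pos.2 log_two_pos)
      (tendsto_rootApprox_div_log κ)).eventually_gt_atTop 0] with n h1 h2 h3 h4
  exact lt_of_fExt_pos h3 h1.1.1 h4 h1.1.2 h1.2 h2

theorem tendsto_root_sub {kHat : ℕ → ℝ} (hkHat : ∀ᶠ n : ℕ in atTop,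
      kHat n ∈ Set.Icc (1 : ℝ) (n : ℝ) ∧ fExt n (kHat n) = 0) :
    Tendsto (fun n : ℕ => kHat n - (logb 2 (n : ℝ) - 2 * logb 2 (log (n : ℝ)) + logb 2 (log 2)))
      atTop (𝓝 0) := by
  have hc := log_two_pos
  have key : ∀ (κ : ℝ) (n : ℕ), rootApprox κ n = (logb 2 (n : ℝ) - 2 * logb 2 (log (n : ℝ)) +
      logb 2 (log 2)) - log κ / log 2 := by
    intro κ n
    simp only [rootApprox, logb]
    ring
  -- The choice κ = 2^(-a) shifts the approximation by exactly a, so κ above or below 1 traps the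
  -- root within any prescribed error.
  have hκ : ∀ (a : ℝ) (n : ℕ), rootApprox (2 ^ (-a)) n = (logb 2 (n : ℝ) -
      2 * logb 2 (log (n : ℝ)) + logb 2 (log 2)) + a := by
    intro a n
    rw [key, log_rpow (by norm_num)]
    field_simp
    ring
  refine tendsto_order.2 ⟨fun a ha => ?_, fun a ha => ?_⟩
  · filter_upwards [eventually_rootApprox_lt hkHat (κ := 2 ^ (-a))
      (one_lt_rpow (by norm_num) (by linarith))] with n hn
    rw [hκ] at hn
    linarith
  · filter_upwards [eventually_lt_rootApprox hkHat (κ := 2 ^ (-a)) (by positivity)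
      (rpow_lt_one_of_one_lt_of_neg (by norm_num) (by linarith))] with n hn
    rw [hκ] at hn
    linarith

theorem tendsto_root_div_log {kHat : ℕ → ℝ} (hkHat : ∀ᶠ n : ℕ in atTop,
      kHat n ∈ Set.Icc (1 : ℝ) (n : ℝ) ∧ fExt n (kHat n) = 0) :
    Tendsto (fun n : ℕ => kHat n / log (n : ℝ)) atTop (𝓝 (1 / log 2)) := by
  refine tendsto_of_tendsto_of_tendsto_of_le_of_le' (tendsto_rootApprox_div_log 2)
    (tendsto_rootApprox_div_log (1 / 2)) ?_ ?_
  · filter_upwards [eventually_rootApprox_lt hkHat (κ := 2) (by norm_num), eventually_log_pos]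
      with n h hn
    gcongr
  · filter_upwards [eventually_lt_rootApprox hkHat (κ := 1 / 2) (by norm_num) (by norm_num),
      eventually_log_pos] with n h hn
    gcongr

theorem eventually_two_rpow_neg_root_lt {kHat : ℕ → ℝ} (hkHat : ∀ᶠ n : ℕ in atTop,
      kHat n ∈ Set.Icc (1 : ℝ) (n : ℝ) ∧ fExt n (kHat n) = 0)
    {κ : ℝ} (hκ : 1 < κ) :
    ∀ᶠ n : ℕ in atTop, (2 : ℝ) ^ (-kHat n) < κ * (log n ^ 2 / log 2) / n := by
  filter_upwards [eventually_rootApprox_lt hkHat hκ, eventually_log_pos] with n h hn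
  rw [← two_rpow_neg_rootApprox (by linarith) hn]
  exact rpow_lt_rpow_of_exponent_lt (by norm_num) (by linarith)

theorem eventually_lt_two_rpow_neg_root {kHat : ℕ → ℝ} (hkHat : ∀ᶠ n : ℕ in atTop,
      kHat n ∈ Set.Icc (1 : ℝ) (n : ℝ) ∧ fExt n (kHat n) = 0)
    {κ : ℝ} (hκ0 : 0 < κ) (hκ : κ < 1) :
    ∀ᶠ n : ℕ in atTop, κ * (log n ^ 2 / log 2) / n < (2 : ℝ) ^ (-kHat n) := by
  filter_upwards [eventually_lt_rootApprox hkHat hκ0 hκ, eventually_log_pos] with n h hn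
  rw [← two_rpow_neg_rootApprox hκ0 hn]
  exact rpow_lt_rpow_of_exponent_lt (by norm_num) (by linarith)

end Root

end Asymptotics

end RandomGraphLogic

namespace RandomGraphLogic

open Real Filter Topology

/-! ### Separated families of patterns -/

section Patterns

/-- The complement of I has at most ⌊s/3⌋ elements, too few to contain either half of the positions
once s ≥ 4; for s = 3 this fails. -/
theorem exists_mem_lt_half {s : ℕ} (hs : 4 ≤ s) {I : Finset (Fin s)} (hI : s - s / 3 ≤ I.card) :
    ∃ i ∈ I, (i : ℕ) < s / 2 := by
  by_contra! h
  have h1 : (I.image Fin.val).card ≤ (Finset.Ico (s / 2) s).card := by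
    refine Finset.card_le_card fun a ha => ?_
    obtain ⟨i, hi, rfl⟩ := Finset.mem_image.1 ha
    exact Finset.mem_Ico.2 ⟨h i hi, i.2⟩
  rw [Finset.card_image_of_injective _ Fin.val_injective, Nat.card_Ico] at h1
  omega

theorem exists_mem_half_le {s : ℕ} (hs : 4 ≤ s) {I : Finset (Fin s)} (hI : s - s / 3 ≤ I.card) :
    ∃ i ∈ I, s / 2 ≤ (i : ℕ) := by
  by_contra! h
  have h1 : (I.image Fin.val).card ≤ (Finset.range (s / 2)).card := by
    refine Finset.card_le_card fun a ha => ?_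
    obtain ⟨i, hi, rfl⟩ := Finset.mem_image.1 ha
    exact Finset.mem_range.2 (h i hi)
  rw [Finset.card_image_of_injective _ Fin.val_injective, Finset.card_range] at h1
  omega

open Classical in
/-- Three patterns, any two of which differ in about half of the indices or in all of them. -/
noncomputable def triplePattern (s : ℕ) : Finset (Set (Fin s)) :=
  {∅, Set.univ, {i : Fin s | (i : ℕ) < s / 2}}

open Classical in
/-- Two complementary patterns. -/
noncomputable def pairPattern (s : ℕ) : Finset (Set (Fin s)) := {∅, Set.univ}

/-- Any two of the patterns differ throughout the first half or throughout the second half, and I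
meets both halves. -/
theorem separated_triplePattern {s : ℕ} (hs : 4 ≤ s) : Separated (triplePattern s) (s - s / 3) := by
  intro A hA B hB I hI hAB
  obtain ⟨a, haI, ha⟩ := exists_mem_lt_half hs hI
  obtain ⟨b, hbI, hb⟩ := exists_mem_half_le hs hI
  have h1 := hAB a haI
  have h2 := hAB b hbI
  simp only [triplePattern, Finset.mem_insert, Finset.mem_singleton] at hA hB
  have ha' : ¬ s / 2 ≤ (a : ℕ) := ha.not_ge
  rcases hA with rfl | rfl | rfl <;> rcases hB with rfl | rfl | rfl <;>
    simp_all [hb.not_gt]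

theorem separated_pairPattern {s : ℕ} (hs : 4 ≤ s) : Separated (pairPattern s) (s - s / 3) := by
  have hsub : pairPattern s ⊆ triplePattern s := by
    intro A
    simp only [pairPattern, triplePattern, Finset.mem_insert, Finset.mem_singleton]
    tauto
  exact fun A hA B hB => separated_triplePattern hs A (hsub hA) B (hsub hB)

theorem card_pairPattern {s : ℕ} (hs : 4 ≤ s) : (pairPattern s).card = 2 := by
  have : Nonempty (Fin s) := ⟨⟨0, by omega⟩⟩
  exact Finset.card_pair Set.empty_ne_univ

theorem card_triplePattern {s : ℕ} (hs : 4 ≤ s) : (triplePattern s).card = 3 := by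
  have : Nonempty (Fin s) := ⟨⟨0, by omega⟩⟩
  refine Finset.card_eq_three.2 ⟨_, _, _, Set.empty_ne_univ, ?_, ?_, rfl⟩
  · intro h
    have : (⟨0, by omega⟩ : Fin s) ∈ (∅ : Set (Fin s)) := by
      rw [h]; simp; omega
    exact this
  · intro h
    have : (⟨s / 2, by omega⟩ : Fin s) ∈ ({i | (i : ℕ) < s / 2} : Set (Fin s)) := by
      rw [← h]; trivial
    simp at this

end Patterns

/-! ### Asymptotics of the moment bounds -/

section MomentAsymptotics

theorem one_sub_pow_le_exp {p : ℝ} (hp : p ≤ 1) (N : ℕ) : (1 - p) ^ N ≤ exp (-(N * p)) := by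
  calc (1 - p) ^ N ≤ exp (-p) ^ N := by
        gcongr
        exact one_sub_le_exp_neg p
    _ = exp (-(N * p)) := by rw [← exp_nat_mul]; ring_nf

theorem exp_le_one_sub_pow {p : ℝ} (hp : p ≤ 1 / 2) (N : ℕ) :
    exp (-(N * (p * (1 + 2 * p)))) ≤ (1 - p) ^ N := by
  calc exp (-(N * (p * (1 + 2 * p)))) = exp (-(p * (1 + 2 * p))) ^ N := by
        rw [← exp_nat_mul]; ring_nf
    _ ≤ exp (log (1 - p)) ^ N := by
        gcongr
        refine le_trans ?_ (neg_div_le_log_one_sub (by linarith))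
        rw [neg_le_neg_iff, div_le_iff₀ (by linarith)]
        -- After clearing the denominator this is p²(1 - 2p) ≥ 0.
        nlinarith [sq_nonneg p]
    _ = (1 - p) ^ N := by rw [exp_log (by linarith)]

theorem natCast_pow_eq_exp {n : ℕ} (hn : 1 ≤ n) (s : ℕ) : (n : ℝ) ^ s = exp (s * log n) := by
  rw [exp_nat_mul, exp_log (by exact_mod_cast hn)]

/-- The small-overlap share of the second moment over the squared mean, to be shown to tend to 1.
The constant 4 comes from (1 - p)² ≥ 1/4; the mismatch of s in the exponents is paid for by
Bernoulli's inequality. -/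
theorem first_ratio_le {n s : ℕ} {p b : ℝ} (hp : p ≤ 1 / 2) (hb : 0 ≤ b)
    (hsn : 2 * s ≤ n) (hsp : 2 * s * p < 1) :
    ((1 - p) ^ 2 + b) ^ (n - 2 * s) / ((1 - p) ^ 2) ^ (n - s) ≤
      exp (4 * (n * b)) / (1 - 2 * s * p) := by
  have hq : 1 / 4 ≤ (1 - p) ^ 2 := by nlinarith
  have h1 : ((1 - p) ^ 2 + b) ^ (n - 2 * s) ≤
      exp (4 * (n * b)) * ((1 - p) ^ 2) ^ (n - 2 * s) := by
    calc ((1 - p) ^ 2 + b) ^ (n - 2 * s) ≤ ((1 - p) ^ 2 * exp (4 * b)) ^ (n - 2 * s) := by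
          gcongr
          have := add_one_le_exp (4 * b)
          nlinarith
      _ = exp ((n - 2 * s : ℕ) * (4 * b)) * ((1 - p) ^ 2) ^ (n - 2 * s) := by
          rw [mul_pow, exp_nat_mul, mul_comm]
      _ ≤ exp (4 * (n * b)) * ((1 - p) ^ 2) ^ (n - 2 * s) := by
          have : ((n - 2 * s : ℕ) : ℝ) ≤ n := by exact_mod_cast Nat.sub_le _ _
          gcongr ?_ * _
          rw [exp_le_exp]
          nlinarith
  have h2 : 1 - 2 * s * p ≤ ((1 - p) ^ 2) ^ s := by
    have := one_add_mul_le_pow (a := -p) (by linarith) (2 * s)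
    rw [← pow_mul]
    push_cast at this
    calc 1 - 2 * s * p = 1 + 2 * s * -p := by ring
      _ ≤ _ := this
      _ = _ := by ring
  have h3 : ((1 - p) ^ 2) ^ (n - s) = ((1 - p) ^ 2) ^ (n - 2 * s) * ((1 - p) ^ 2) ^ s := by
    rw [← pow_add]; congr 1; omega
  rw [h3, div_le_div_iff₀ (by positivity) (by linarith)]
  calc ((1 - p) ^ 2 + b) ^ (n - 2 * s) * (1 - 2 * s * p)
      ≤ (exp (4 * (n * b)) * ((1 - p) ^ 2) ^ (n - 2 * s)) * ((1 - p) ^ 2) ^ s := by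
        gcongr
    _ = _ := by ring

/-- The large-overlap share. Correlation costs 2p - 3p/2 = p/2 per vertex, a factor of about
exp(pn/2), while only t of the s entries of the second tuple are free, which saves about n^(s-t). -/
theorem second_ratio_le {n s t : ℕ} {p : ℝ} (hp0 : 0 ≤ p) (hp : p ≤ 1 / 2) (hs : 1 ≤ s)
    (hsn : 2 * s ≤ n) :
    2 ^ s * (s ^ s * n ^ t) * (1 - 3 / 2 * p) ^ (n - 2 * s) /
        (n.descFactorial s * ((1 - p) ^ 2) ^ (n - s)) ≤
      exp (s * log 2 + s * log s + t * log n - s * (log n - log 2) +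
        p * (n / 2 + 3 * s + 4 * p * n)) := by
  have hn : 1 ≤ n := by omega
  have hn' : (0 : ℝ) < n := by exact_mod_cast hn
  have hD : exp (s * (log n - log 2)) ≤ n.descFactorial s := by
    have h1 : ((n + 1 - s : ℕ) : ℝ) ^ s ≤ n.descFactorial s := by
      exact_mod_cast Nat.pow_sub_le_descFactorial n s
    refine le_trans ?_ h1
    rw [exp_nat_mul, ← log_div hn'.ne' (by norm_num), exp_log (by positivity)]
    gcongr
    have : (n : ℝ) ≤ ((2 * (n + 1 - s) : ℕ) : ℝ) := by exact_mod_cast (by omega)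
    push_cast at this
    linarith
  have hq : exp (-(2 * ((n - s : ℕ) * (p * (1 + 2 * p))))) ≤ ((1 - p) ^ 2) ^ (n - s) := by
    rw [pow_right_comm, show -(2 * (((n - s : ℕ) : ℝ) * (p * (1 + 2 * p)))) =
      (2 : ℕ) * -(((n - s : ℕ) : ℝ) * (p * (1 + 2 * p))) by push_cast; ring, exp_nat_mul]
    gcongr
    exact exp_le_one_sub_pow hp _
  have hr : (1 - 3 / 2 * p) ^ (n - 2 * s) ≤ exp (-((n - 2 * s : ℕ) * (3 / 2 * p))) :=
    one_sub_pow_le_exp (by linarith) _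
  have h2 : (2 : ℝ) ^ s = exp (s * log 2) := by
    exact_mod_cast natCast_pow_eq_exp (n := 2) (by norm_num) s
  calc 2 ^ s * (s ^ s * n ^ t) * (1 - 3 / 2 * p) ^ (n - 2 * s) /
        (n.descFactorial s * ((1 - p) ^ 2) ^ (n - s))
      ≤ exp (s * log 2) * (exp (s * log s) * exp (t * log n)) *
          exp (-((n - 2 * s : ℕ) * (3 / 2 * p))) /
          (exp (s * (log n - log 2)) * exp (-(2 * ((n - s : ℕ) * (p * (1 + 2 * p)))))) := by
        rw [h2, natCast_pow_eq_exp hs, natCast_pow_eq_exp hn]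
        gcongr
    _ = exp (s * log 2 + s * log s + t * log n - s * (log n - log 2) +
          (2 * ((n - s : ℕ) * (p * (1 + 2 * p))) - (n - 2 * s : ℕ) * (3 / 2 * p))) := by
        simp only [← exp_add, ← exp_sub]
        ring_nf
    _ ≤ _ := by
        gcongr
        rw [Nat.cast_sub (by omega), Nat.cast_sub hsn]
        push_cast
        have h3 : 0 ≤ p * (s : ℝ) := by positivity
        have h4 : 0 ≤ p * p * (s : ℝ) := by positivity
        nlinarith

theorem factorial_div_eq {n s : ℕ} (Q : ℝ) :
    (s.factorial : ℝ) / (n.descFactorial s * Q) = 1 / (n.choose s * Q) := by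
  have h : (0 : ℝ) < s.factorial := by exact_mod_cast Nat.factorial_pos s
  rw [Nat.descFactorial_eq_factorial_mul_choose]
  push_cast
  rw [mul_assoc, div_mul_eq_div_div, div_self h.ne']

/-- Two forbidden patterns on s vertices have the same density as one on s - 1 vertices, so the
expected number of avoiding sets can be compared with exp(`fExt`) at s - 1: the binomial coefficient
gains at least n/(2s) and the factor 2^(s-1) is lost. -/
theorem factorial_div_le_of_fExt_pos {n s : ℕ} (hs : 2 ≤ s) (hsn : 2 * s ≤ n)
    (h : 0 < fExt n ((s - 1 : ℕ) : ℝ)) :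
    (s.factorial : ℝ) / (n.descFactorial s * (1 - 2 / 2 ^ s : ℝ) ^ (n - s)) ≤ s * (2 ^ s / n) := by
  have hn : (0 : ℝ) < n := by exact_mod_cast (by omega : 0 < n)
  have hs0 : (0 : ℝ) < s := by exact_mod_cast (by omega : 0 < s)
  obtain ⟨t, rfl⟩ : ∃ t, s = t + 1 := ⟨s - 1, by omega⟩
  have hq : (1 - 2 / 2 ^ (t + 1) : ℝ) = 1 - 1 / 2 ^ t := by
    rw [pow_succ]; field_simp
  have hq0 : (0 : ℝ) < 1 - 1 / 2 ^ t := by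
    rw [sub_pos, div_lt_one (by positivity)]
    exact one_lt_pow₀ (by norm_num) (by omega)
  rw [Nat.add_sub_cancel, fExt_natCast (by omega),
    log_pos_iff (by positivity), show n - t = n - (t + 1) + 1 by omega, pow_succ] at h
  rw [factorial_div_eq, hq]
  set Q := (1 - 1 / 2 ^ t : ℝ) ^ (n - (t + 1)) with hQ
  have hQ0 : 0 < Q := by positivity
  have hch : (n.choose (t + 1) : ℝ) * (t + 1 : ℕ) = n.choose t * (n - t : ℕ) := by
    exact_mod_cast Nat.choose_succ_right_eq n t
  have hnt : (n : ℝ) / 2 ≤ (n - t : ℕ) := by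
    have : (n : ℝ) ≤ ((2 * (n - t) : ℕ) : ℝ) := by exact_mod_cast (by omega)
    push_cast at this
    linarith
  have h1 : 1 < n.choose t * 2 ^ t * Q := by
    refine h.trans_le ?_
    rw [← mul_assoc]
    have : (0 : ℝ) < 1 / 2 ^ t := by positivity
    nlinarith [show (0 : ℝ) ≤ n.choose t * 2 ^ t * Q by positivity]
  have hC0 : (0 : ℝ) < n.choose (t + 1) := by exact_mod_cast Nat.choose_pos (by omega)
  rw [div_le_iff₀ (by positivity)]
  have h2 : ((t + 1 : ℕ) : ℝ) * (2 ^ (t + 1) / n) * (n.choose (t + 1) * Q) =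
      (n.choose t * 2 ^ t * Q) * ((n - t : ℕ) / (n / 2)) := by
    calc ((t + 1 : ℕ) : ℝ) * (2 ^ (t + 1) / n) * (n.choose (t + 1) * Q) =
        (n.choose (t + 1) * (t + 1 : ℕ)) * (2 ^ (t + 1) / n * Q) := by ring
      _ = _ := by rw [hch, pow_succ]; field_simp
  rw [h2]
  have h3 : 1 ≤ ((n - t : ℕ) : ℝ) / (n / 2) := by rwa [one_le_div (by positivity)]
  nlinarith

/-- A cruder bound on the reciprocal of the expected number of avoiding sets, useful when np is
below s ln n by a constant factor. -/
theorem factorial_div_le_exp {n s : ℕ} {p : ℝ} (hp0 : 0 ≤ p) (hp : p ≤ 1 / 2) (hs : 1 ≤ s)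
    (hsn : 2 * s ≤ n) :
    (s.factorial : ℝ) / (n.descFactorial s * (1 - p) ^ (n - s)) ≤
      exp (-(s * (log n - log (2 * s))) + n * p * (1 + 2 * p)) := by
  have hC0 : (0 : ℝ) < n.choose s := by exact_mod_cast Nat.choose_pos (by omega)
  have h1 : exp (s * (log n - log (2 * s))) ≤ n.choose s := by
    rw [← exp_log hC0]
    exact exp_le_exp.2 (mul_log_le_log_choose hs hsn)
  have h2 := exp_le_one_sub_pow hp (n - s)
  have h3 : exp (-(n * (p * (1 + 2 * p)))) ≤ exp (-((n - s : ℕ) * (p * (1 + 2 * p)))) := by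
    gcongr
    omega
  rw [factorial_div_eq, exp_add, exp_neg]
  calc 1 / (n.choose s * (1 - p) ^ (n - s)) ≤
      1 / (exp (s * (log n - log (2 * s))) * exp (-(n * (p * (1 + 2 * p))))) := by
        gcongr
        exact h3.trans h2
    _ = _ := by
        rw [one_div, mul_inv, ← exp_neg (-_), neg_neg]
        ring_nf

end MomentAsymptotics

end RandomGraphLogic

namespace RandomGraphLogic

open Real Filter Topology

/-! ### Limits of the first and second moment bounds -/

section Limits

/-- Random graphs have the extension property well below the threshold. -/
theorem tendsto_uprob_not_hasExtensions {m : ℕ → ℕ}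
    (hm : Tendsto (fun n : ℕ => (m n : ℝ) / log (n : ℝ)) atTop (𝓝 (1 / log 2)))
    (hlam : ∀ᶠ n : ℕ in atTop, 3 / 2 * (log n ^ 2 / log 2) ≤ (n : ℝ) / 2 ^ m n) :
    Tendsto (fun n : ℕ => uprob fun G : SimpleGraph (Fin n) => ¬ HasExtensions G (m n)) atTop
      (𝓝 0) := by
  have hc := log_two_pos
  -- In units of W = (ln n)²/ln 2 the exponent of the union bound tends to 1 - 3/2 < 0.
  have h1 : Tendsto (fun n : ℕ => (m n * (log 2 + log n) -
      3 / 2 * (log n ^ 2 / log 2) * (1 - m n / n)) / log (n : ℝ) ^ 2) atTop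
      (𝓝 (1 / log 2 * (0 + 1) - 3 / 2 * (1 / log 2) * (1 - 0))) := by
    refine Tendsto.congr' ?_ ((hm.mul ((tendsto_const_div_log (log 2)).add
      (tendsto_const_nhds (x := (1 : ℝ))))).sub
      ((tendsto_const_nhds (x := 3 / 2 * (1 / log 2))).mul
        (tendsto_const_nhds.sub (tendsto_div_nat_of_div_log hm))))
    filter_upwards [eventually_log_pos] with n hn
    field_simp
  have hneg : 1 / log 2 * (0 + 1) - 3 / 2 * (1 / log 2) * (1 - 0) < 0 := by
    have : 0 < 1 / log 2 := by positivity
    linarith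
  refine squeeze_zero' (Eventually.of_forall fun n => uprob_nonneg _) ?_
    (tendsto_exp_of_div_sq_log hneg h1)
  filter_upwards [hlam, eventually_le_mul_nat_of_div_log one_pos hm, eventually_ge_atTop 1]
    with n hl hmn hn
  have hmn' : m n ≤ n := by
    rw [one_mul] at hmn
    exact_mod_cast hmn
  have hn0 : (0 : ℝ) < n := by exact_mod_cast hn
  refine (uprob_not_hasExtensions_le hmn').trans ?_
  have e1 : ((2 * n : ℝ)) ^ m n = exp (m n * (log 2 + log n)) := by
    rw [exp_nat_mul, exp_add, exp_log (by norm_num), exp_log hn0]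
  have hle : (1 : ℝ) / 2 ^ m n ≤ 1 := by
    rw [div_le_one (by positivity)]
    exact one_le_pow₀ (by norm_num)
  have e2 := one_sub_pow_le_exp hle (n - m n)
  have e3 : 3 / 2 * (log n ^ 2 / log 2) * (1 - m n / n) ≤ (n - m n : ℕ) * (1 / 2 ^ m n) := by
    have h0 : 0 ≤ 1 - (m n : ℝ) / n := by
      rw [sub_nonneg, div_le_one hn0]; exact_mod_cast hmn'
    calc 3 / 2 * (log n ^ 2 / log 2) * (1 - m n / n) ≤ n / 2 ^ m n * (1 - m n / n) := by gcongr
      _ = _ := by rw [Nat.cast_sub hmn']; field_simp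
  calc (2 * n : ℝ) ^ m n * (1 - 1 / 2 ^ m n) ^ (n - m n)
      ≤ exp (m n * (log 2 + log n)) * exp (-((n - m n : ℕ) * (1 / 2 ^ m n))) := by
        rw [e1]; gcongr
    _ = exp (m n * (log 2 + log n) - (n - m n : ℕ) * (1 / 2 ^ m n)) := by
        rw [← exp_add, sub_eq_add_neg]
    _ ≤ _ := by gcongr

variable {s : ℕ → ℕ} {𝒜 : ∀ n, Finset (Set (Fin (s n)))}

/-- Every single graph is unlikely to be induced on an avoiding tuple. -/
theorem exists_tendsto_zero_uprob_exists_avoids_comap_eq_le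
    (hs : Tendsto (fun n : ℕ => (s n : ℝ) / log (n : ℝ)) atTop (𝓝 (1 / log 2)))
    (hlam : ∀ᶠ n : ℕ in atTop, 59 / 100 * (log n ^ 2 / log 2) ≤ n * ((𝒜 n).card / 2 ^ s n)) :
    ∃ ε : ℕ → ℝ, Tendsto ε atTop (𝓝 0) ∧ ∀ᶠ n in atTop, ∀ F : SimpleGraph (Fin (s n)),
      uprob (fun G : SimpleGraph (Fin n) => ∃ x : Fin (s n) ↪ Fin n,
        G.comap x = F ∧ Avoids G (𝒜 n) x) ≤ ε n := by
  have hc := log_two_pos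
  -- In units of W = (ln n)²/ln 2: 1 for the choice of the tuple, -1/2 for the prescribed induced
  -- graph, -59/100 for avoidance. Any constant above 1/2 would do in place of 59/100.
  have h1 : Tendsto (fun n : ℕ => (s n * log n - s n * (s n - 1) / 2 * log 2 -
      59 / 100 * (log n ^ 2 / log 2) * (1 - s n / n)) / log (n : ℝ) ^ 2) atTop
      (𝓝 (1 / log 2 - 1 / log 2 * (1 / log 2 - 0) / 2 * log 2 -
        59 / 100 * (1 / log 2) * (1 - 0))) := by
    refine Tendsto.congr' ?_ ((hs.sub (((hs.mul (hs.sub (tendsto_const_div_log 1))).div_const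
      2).mul_const (log 2))).sub ((tendsto_const_nhds (x := 59 / 100 * (1 / log 2))).mul
        (tendsto_const_nhds.sub (tendsto_div_nat_of_div_log hs))))
    filter_upwards [eventually_log_pos] with n hn
    field_simp
  have hneg : 1 / log 2 - 1 / log 2 * (1 / log 2 - 0) / 2 * log 2 -
        59 / 100 * (1 / log 2) * (1 - 0) < 0 := by
    have : 0 < 1 / log 2 := by positivity
    have h2 : 1 / log 2 * (1 / log 2 - 0) / 2 * log 2 = 1 / log 2 / 2 := by field_simp; ring
    rw [h2]
    linarith
  refine ⟨_, tendsto_exp_of_div_sq_log hneg h1, ?_⟩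
  filter_upwards [hlam, eventually_le_mul_nat_of_div_log one_pos hs, eventually_ge_atTop 1]
    with n hl hsn hn F
  have hsn' : s n ≤ n := by
    rw [one_mul] at hsn
    exact_mod_cast hsn
  have hn0 : (0 : ℝ) < n := by exact_mod_cast hn
  refine (uprob_exists_avoids_comap_eq_le (𝒜 n) F).trans ?_
  have e2 := one_sub_pow_le_exp (p := (𝒜 n).card / 2 ^ s n)
    (by linarith [one_sub_div_two_pow_nonneg (𝒜 n)]) (n - s n)
  have e3 : 59 / 100 * (log n ^ 2 / log 2) * (1 - s n / n) ≤
      (n - s n : ℕ) * ((𝒜 n).card / 2 ^ s n) := by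
    have h0 : 0 ≤ 1 - (s n : ℝ) / n := by
      rw [sub_nonneg, div_le_one hn0]; exact_mod_cast hsn'
    calc 59 / 100 * (log n ^ 2 / log 2) * (1 - s n / n)
        ≤ n * ((𝒜 n).card / 2 ^ s n) * (1 - s n / n) := by gcongr
      _ = _ := by rw [Nat.cast_sub hsn']; field_simp
  have e4 : (2 : ℝ) ^ (s n).choose 2 = exp (s n * (s n - 1) / 2 * log 2) := by
    rw [← Nat.cast_choose_two, exp_nat_mul, exp_log (by norm_num)]
  calc (n : ℝ) ^ s n * (1 / 2 ^ (s n).choose 2 * (1 - (𝒜 n).card / 2 ^ s n) ^ (n - s n))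
      ≤ exp (s n * log n) * (1 / exp (s n * (s n - 1) / 2 * log 2) *
          exp (-((n - s n : ℕ) * ((𝒜 n).card / 2 ^ s n)))) := by
        rw [natCast_pow_eq_exp hn, e4]; gcongr
    _ = exp (s n * log n - s n * (s n - 1) / 2 * log 2 -
          (n - s n : ℕ) * ((𝒜 n).card / 2 ^ s n)) := by
        rw [one_div, ← exp_neg, ← exp_add, ← exp_add]
        ring_nf
    _ ≤ _ := by gcongr

/-- Avoiding tuples exist with high probability if their expected number tends to infinity. -/
theorem tendsto_uprob_exists_avoids
    (hs : Tendsto (fun n : ℕ => (s n : ℝ) / log (n : ℝ)) atTop (𝓝 (1 / log 2)))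
    (hcard : ∀ n, (𝒜 n).card ≤ 3)
    (hsep : ∀ᶠ n in atTop, Separated (𝒜 n) (s n - s n / 3))
    (hlam : ∀ᶠ n : ℕ in atTop, n * ((𝒜 n).card / 2 ^ s n : ℝ) ≤ 102 / 100 * (log n ^ 2 / log 2))
    (hE : Tendsto (fun n : ℕ => ((s n).factorial : ℝ) / (n.descFactorial (s n) *
      (1 - (𝒜 n).card / 2 ^ s n : ℝ) ^ (n - s n))) atTop (𝓝 0)) :
    Tendsto (fun n : ℕ => uprob fun G : SimpleGraph (Fin n) =>
      ∃ x : Fin (s n) ↪ Fin n, Avoids G (𝒜 n) x) atTop (𝓝 1) := by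
  have hc := log_two_pos
  set P : ℕ → ℝ := fun n => 102 / 100 * (log n ^ 2 / log 2) / n with hP
  have hPlim : Tendsto P atTop (𝓝 0) := by
    have := (tendsto_log_pow_div_nat 2).const_mul (102 / 100 / log 2)
    rw [mul_zero] at this
    refine this.congr fun n => ?_
    simp only [hP]
    ring
  have hsP : Tendsto (fun n => 2 * s n * P n) atTop (𝓝 0) := by
    have := (hs.mul (tendsto_log_pow_div_nat 3)).const_mul (2 * (102 / 100 / log 2))
    rw [mul_zero, mul_zero] at this
    refine this.congr' ?_
    filter_upwards [eventually_log_pos] with n hn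
    simp only [hP]
    field_simp
  have hB : Tendsto (fun n : ℕ => 8 / log 2 * exp (2 * log (log n) - s n / 3 * log 2)) atTop
      (𝓝 0) := by
    have h1 : Tendsto (fun n : ℕ => (2 * log (log n) - s n / 3 * log 2) / log (n : ℝ)) atTop
        (𝓝 (2 * 0 - 1 / log 2 * (log 2 / 3))) := by
      refine ((tendsto_loglog_div_log.const_mul 2).sub (hs.mul_const (log 2 / 3))).congr fun n => ?_
      ring
    have := (tendsto_exp_of_div_log (by field_simp; norm_num) h1).const_mul (8 / log 2)
    rwa [mul_zero] at this
  have hT1 : Tendsto (fun n : ℕ => exp (4 * (8 / log 2 * exp (2 * log (log n) -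
      s n / 3 * log 2))) / (1 - 2 * s n * P n)) atTop (𝓝 1) := by
    have h1 : Tendsto (fun n : ℕ => exp (4 * (8 / log 2 * exp (2 * log (log n) -
      s n / 3 * log 2)))) atTop (𝓝 (exp (4 * 0))) :=
        (continuous_exp.tendsto _).comp (hB.const_mul 4)
    have := h1.div (tendsto_const_nhds.sub hsP) (by norm_num : (1 : ℝ) - 0 ≠ 0)
    rw [mul_zero, exp_zero, sub_zero, div_one] at this
    exact this
  -- Again in units of W: 1/3 for the free entries of the second tuple, -1 for normalising by the
  -- number of tuples, and at most (102/100)/2 for the correlation. The total is negative, which is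
  -- why the overlap threshold is taken near 2s/3.
  have hT2 : Tendsto (fun n : ℕ => exp (s n * log 2 + s n * log (s n) + s n / 3 * log n -
      s n * (log n - log 2) + P n * (n / 2 + 3 * s n + 4 * P n * n))) atTop (𝓝 0) := by
    refine tendsto_exp_of_div_sq_log (L := 1 / log 2 * 0 + 1 / log 2 * 0 + 1 / log 2 / 3 -
      1 / log 2 * (1 - 0) + 102 / 100 / log 2 * (1 / 2 + 3 * 0 + 4 * 0)) ?_ ?_
    · have : 0 < 1 / log 2 := by positivity
      have e : 102 / 100 / log 2 = 102 / 100 * (1 / log 2) := by ring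
      rw [e]
      linarith
    · refine Tendsto.congr' ?_ (((((hs.mul (tendsto_const_div_log (log 2))).add
        (hs.mul (tendsto_log_div_log_of_div_log (by positivity) hs))).add (hs.div_const 3)).sub
        (hs.mul (tendsto_const_nhds.sub (tendsto_const_div_log (log 2))))).add
        ((tendsto_const_nhds (x := 102 / 100 / log 2)).mul ((tendsto_const_nhds.add
          ((tendsto_div_nat_of_div_log hs).const_mul 3)).add (hPlim.const_mul 4))))
      filter_upwards [eventually_log_pos, eventually_gt_atTop 0] with n hn hn0
      have hn0 : (0 : ℝ) < n := by exact_mod_cast hn0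
      simp only [hP]
      field_simp
  have hR := (hT1.add hT2).add hE
  rw [add_zero, add_zero] at hR
  have hlow := hR.inv₀ one_ne_zero
  rw [inv_one] at hlow
  refine tendsto_of_tendsto_of_tendsto_of_le_of_le' hlow tendsto_const_nhds ?_
    (Eventually.of_forall fun n => uprob_le_one _)
  filter_upwards [hlam, hsep, hPlim.eventually_le_const (by norm_num : (0 : ℝ) < 1 / 2),
    hsP.eventually_lt_const one_pos, hR.eventually_const_lt one_pos, eventually_log_pos,
    (tendsto_atTop_of_div_log (by positivity) hs).eventually_ge_atTop 1,
    eventually_le_mul_nat_of_div_log (ε := 1 / 2) (by norm_num) hs, eventually_ge_atTop 1]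
    with n hl hsp hPn hsPn hRn hlog hs1 hsn hn
  have hn0 : (0 : ℝ) < n := by exact_mod_cast hn
  have hs1' : 1 ≤ s n := by exact_mod_cast hs1
  have hsn' : 2 * s n ≤ n := by
    have : ((2 * s n : ℕ) : ℝ) ≤ n := by push_cast; linarith
    exact_mod_cast this
  set p : ℝ := (𝒜 n).card / 2 ^ s n with hp
  have hp0 : 0 ≤ p := by positivity
  have hpP : p ≤ P n := by
    have hPdef : P n = 102 / 100 * (log n ^ 2 / log 2) / n := rfl
    rw [hPdef, le_div_iff₀ hn0]
    linarith
  have hb : n * ((𝒜 n).card ^ 2 / 2 ^ (2 * s n - (s n - s n / 3)) : ℝ) ≤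
      8 / log 2 * exp (2 * log (log n) - s n / 3 * log 2) := by
    have e1 : 2 * s n - (s n - s n / 3) = s n + s n / 3 := by omega
    -- On the left s/3 is a real quotient and on the right a floor; rounding costs at most a factor
    -- 2.
    have e2 : exp (s n / 3 * log 2) ≤ 2 * 2 ^ (s n / 3) := by
      rw [← pow_succ']
      calc exp (s n / 3 * log 2) ≤ exp ((s n / 3 + 1 : ℕ) * log 2) := by
            gcongr
            have : (s n : ℝ) ≤ ((3 * (s n / 3 + 1) : ℕ) : ℝ) := by
              exact_mod_cast (by omega)
            push_cast at this ⊢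
            linarith
        _ = 2 ^ (s n / 3 + 1) := by rw [exp_nat_mul, exp_log (by norm_num)]
    have e3 : exp (2 * log (log n)) = log n ^ 2 := by
      rw [show (2 : ℝ) * log (log n) = (2 : ℕ) * log (log n) by norm_num, exp_nat_mul, exp_log hlog]
    have h3 : ((𝒜 n).card : ℝ) ≤ 3 := by exact_mod_cast hcard n
    rw [e1, exp_sub, e3]
    calc n * ((𝒜 n).card ^ 2 / 2 ^ (s n + s n / 3) : ℝ) =
        (n * p) * ((𝒜 n).card / 2 ^ (s n / 3)) := by
          rw [hp, pow_add]; field_simp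
      _ ≤ (102 / 100 * (log n ^ 2 / log 2)) * (3 / (exp (s n / 3 * log 2) / 2)) := by
          gcongr
          linarith
      _ = 612 / 100 / log 2 * (log n ^ 2 / exp (s n / 3 * log 2)) := by field_simp; norm_num
      _ ≤ _ := by gcongr; norm_num
  have h1 := first_ratio_le (n := n) (s := s n) (p := p)
    (b := (𝒜 n).card ^ 2 / 2 ^ (2 * s n - (s n - s n / 3))) (hpP.trans hPn) (by positivity) hsn'
    ((by gcongr : 2 * s n * p ≤ 2 * s n * P n).trans_lt hsPn)
  have h2 := second_ratio_le (t := s n - (s n - s n / 3)) hp0 (hpP.trans hPn) hs1' hsn'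
  have h3 := one_le_uprob_exists_avoids_mul (n := n) hsp hs1' (by omega) (hpP.trans hPn)
  rw [← hp] at h3
  rw [inv_eq_one_div, div_le_iff₀ hRn]
  refine h3.trans ?_
  refine mul_le_mul_of_nonneg_left ?_ (uprob_nonneg _)
  gcongr ?_ + ?_ + _
  · refine h1.trans ?_
    gcongr
  · refine h2.trans ?_
    have ht : ((s n - (s n - s n / 3) : ℕ) : ℝ) ≤ s n / 3 := by
      rw [show s n - (s n - s n / 3) = s n / 3 by omega]
      exact Nat.cast_div_le
    gcongr

end Limits

end RandomGraphLogic

namespace RandomGraphLogic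

open Real Filter Topology

/-! ### The parameters near the root -/

section Parameters

variable {kHat : ℕ → ℝ}

theorem tendsto_floor_root_add_div_log (hkHat : ∀ᶠ n : ℕ in atTop,
      kHat n ∈ Set.Icc (1 : ℝ) (n : ℝ) ∧ fExt n (kHat n) = 0) (a : ℝ) :
    Tendsto (fun n : ℕ => ((⌊kHat n⌋₊ : ℝ) + a) / log (n : ℝ)) atTop (𝓝 (1 / log 2)) := by
  have h := tendsto_root_div_log hkHat
  have h1 : Tendsto (fun n : ℕ => kHat n / log (n : ℝ) + (a - 1) / log (n : ℝ)) atTop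
      (𝓝 (1 / log 2)) := by simpa using h.add (tendsto_const_div_log (a - 1))
  have h2 : Tendsto (fun n : ℕ => kHat n / log (n : ℝ) + a / log (n : ℝ)) atTop
      (𝓝 (1 / log 2)) := by simpa using h.add (tendsto_const_div_log a)
  refine tendsto_of_tendsto_of_tendsto_of_le_of_le' h1 h2 ?_ ?_
  · filter_upwards [eventually_log_pos] with n hn
    rw [← add_div]
    exact div_le_div_of_nonneg_right (by linarith [Nat.lt_floor_add_one (kHat n)]) hn.le
  · filter_upwards [eventually_log_pos, hkHat] with n hn hk
    rw [← add_div]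
    gcongr
    exact Nat.floor_le (by linarith [hk.1.1])

theorem eventually_floor_root_ge (hkHat : ∀ᶠ n : ℕ in atTop,
      kHat n ∈ Set.Icc (1 : ℝ) (n : ℝ) ∧ fExt n (kHat n) = 0) :
    ∀ᶠ n : ℕ in atTop, 4 ≤ ⌊kHat n⌋₊ := by
  filter_upwards [(tendsto_atTop_of_div_log (one_div_pos.2 log_two_pos)
    (tendsto_floor_root_add_div_log hkHat 0)).eventually_ge_atTop 4] with n hn
  rw [add_zero] at hn
  exact_mod_cast hn

theorem eventually_le_div_two_pow_floor (hkHat : ∀ᶠ n : ℕ in atTop,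
      kHat n ∈ Set.Icc (1 : ℝ) (n : ℝ) ∧ fExt n (kHat n) = 0) :
    ∀ᶠ n : ℕ in atTop, 97 / 100 * (log n ^ 2 / log 2) ≤ (n : ℝ) / 2 ^ ⌊kHat n⌋₊ := by
  filter_upwards [hkHat, eventually_lt_two_rpow_neg_root hkHat (κ := 97 / 100) (by norm_num)
    (by norm_num), eventually_gt_atTop 0] with n hk h hn
  have hn0 : (0 : ℝ) < n := by exact_mod_cast hn
  rw [div_lt_iff₀ hn0] at h
  refine h.le.trans ?_
  rw [mul_comm, div_eq_mul_inv, ← rpow_natCast, ← rpow_neg (by norm_num)]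
  have := Nat.floor_le (by linarith [hk.1.1] : 0 ≤ kHat n)
  gcongr
  · norm_num

theorem eventually_div_two_pow_floor_le (hkHat : ∀ᶠ n : ℕ in atTop,
      kHat n ∈ Set.Icc (1 : ℝ) (n : ℝ) ∧ fExt n (kHat n) = 0) :
    ∀ᶠ n : ℕ in atTop, (n : ℝ) / 2 ^ (⌊kHat n⌋₊ + 1) ≤ 102 / 100 * (log n ^ 2 / log 2) := by
  filter_upwards [hkHat, eventually_two_rpow_neg_root_lt hkHat (κ := 102 / 100) (by norm_num),
    eventually_gt_atTop 0] with n hk h hn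
  have hn0 : (0 : ℝ) < n := by exact_mod_cast hn
  rw [lt_div_iff₀ hn0] at h
  refine le_trans ?_ h.le
  rw [mul_comm ((2 : ℝ) ^ _), div_eq_mul_inv, ← rpow_natCast, ← rpow_neg (by norm_num)]
  have := Nat.lt_floor_add_one (kHat n)
  gcongr
  · norm_num
  · push_cast
    exact this.le

/-- ⌊k̂⌋ + 1 lies strictly right of the root, on the stretch where the function increases. For s =
⌊k̂⌋ + 2 this is the value at s - 1. -/
theorem eventually_fExt_floor_root_pos (hkHat : ∀ᶠ n : ℕ in atTop,
      kHat n ∈ Set.Icc (1 : ℝ) (n : ℝ) ∧ fExt n (kHat n) = 0) :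
    ∀ᶠ n : ℕ in atTop, 0 < fExt n ((⌊kHat n⌋₊ + 1 : ℕ) : ℝ) := by
  filter_upwards [hkHat, eventually_le_mul_nat_of_div_log (ε := 1 / 2) (by norm_num)
    (tendsto_floor_root_add_div_log hkHat 1)] with n hk h
  rw [← hk.2]
  refine fExt_lt_fExt (by linarith [hk.1.1]) ?_ ?_
  · push_cast; exact Nat.lt_floor_add_one _
  · push_cast; linarith

theorem tendsto_uprob_not_hasExtensions_floor_root (hkHat : ∀ᶠ n : ℕ in atTop,
      kHat n ∈ Set.Icc (1 : ℝ) (n : ℝ) ∧ fExt n (kHat n) = 0) :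
    Tendsto (fun n : ℕ => uprob fun G : SimpleGraph (Fin n) => ¬ HasExtensions G (⌊kHat n⌋₊ - 1))
      atTop (𝓝 0) := by
  refine tendsto_uprob_not_hasExtensions ?_ ?_
  · refine (tendsto_floor_root_add_div_log hkHat (-1)).congr' ?_
    filter_upwards [eventually_floor_root_ge hkHat] with n hn
    rw [Nat.cast_sub (by omega), Nat.cast_one, sub_eq_add_neg]
  · filter_upwards [eventually_floor_root_ge hkHat, eventually_le_div_two_pow_floor hkHat]
      with n hn h
    obtain ⟨m, hm⟩ : ∃ m, ⌊kHat n⌋₊ = m + 1 := ⟨⌊kHat n⌋₊ - 1, by omega⟩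
    rw [hm, pow_succ (2 : ℝ) m, ← div_div] at h
    rw [hm, Nat.add_sub_cancel]
    have : 0 ≤ log n ^ 2 / log 2 := by have := log_two_pos; positivity
    linarith

/-- Patterns for which avoiding tuples of length `⌊kHat n⌋₊ + 2` exist with high probability, but
any given graph is unlikely to be induced on an avoiding tuple. -/
theorem exists_patterns (hkHat : ∀ᶠ n : ℕ in atTop,
      kHat n ∈ Set.Icc (1 : ℝ) (n : ℝ) ∧ fExt n (kHat n) = 0) :
    ∃ 𝒜 : ∀ n, Finset (Set (Fin (⌊kHat n⌋₊ + 2))),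
      Tendsto (fun n : ℕ => uprob fun G : SimpleGraph (Fin n) =>
        ∃ x : Fin (⌊kHat n⌋₊ + 2) ↪ Fin n, Avoids G (𝒜 n) x) atTop (𝓝 1) ∧
      ∃ ε : ℕ → ℝ, Tendsto ε atTop (𝓝 0) ∧
        ∀ᶠ n in atTop, ∀ F : SimpleGraph (Fin (⌊kHat n⌋₊ + 2)),
          uprob (fun G : SimpleGraph (Fin n) => ∃ x : Fin (⌊kHat n⌋₊ + 2) ↪ Fin n,
            G.comap x = F ∧ Avoids G (𝒜 n) x) ≤ ε n := by
  classical
  have hc := log_two_pos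
  let s : ℕ → ℕ := fun n => ⌊kHat n⌋₊ + 2
  -- With W = (ln n)²/ln 2, n/2^s lies between 0.24 W and 0.51 W. Two patterns used from 0.3 W on
  -- give λ between 0.6 W and 1.02 W; three patterns used below 0.3 W give λ between 0.72 W and 0.9
  -- W. Both ranges stay above 0.59 W, as the bound for a single induced graph requires.
  let 𝒜 : ∀ n, Finset (Set (Fin (s n))) := fun n =>
    if 3 / 10 * (log n ^ 2 / log 2) ≤ (n : ℝ) / 2 ^ s n then pairPattern (s n)
    else triplePattern (s n)
  have hs : Tendsto (fun n : ℕ => (s n : ℝ) / log (n : ℝ)) atTop (𝓝 (1 / log 2)) := by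
    refine (tendsto_floor_root_add_div_log hkHat 2).congr fun n => ?_
    simp [s]
  have hlow : ∀ᶠ n : ℕ in atTop, 24 / 100 * (log n ^ 2 / log 2) ≤ (n : ℝ) / 2 ^ s n := by
    filter_upwards [eventually_le_div_two_pow_floor hkHat] with n h
    have : (n : ℝ) / 2 ^ s n = n / 2 ^ ⌊kHat n⌋₊ / 4 := by
      simp only [s, pow_add]; field_simp; norm_num
    rw [this]
    have : 0 ≤ log n ^ 2 / log 2 := by positivity
    linarith
  have hup : ∀ᶠ n : ℕ in atTop, (n : ℝ) / 2 ^ s n ≤ 51 / 100 * (log n ^ 2 / log 2) := by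
    filter_upwards [eventually_div_two_pow_floor_le hkHat] with n h
    have : (n : ℝ) / 2 ^ s n = n / 2 ^ (⌊kHat n⌋₊ + 1) / 2 := by
      simp only [s, pow_add]; field_simp
    rw [this]
    linarith
  have hs4 : ∀ n, 4 ≤ ⌊kHat n⌋₊ → 4 ≤ s n := fun n hn => by simp only [s]; omega
  have hmul : ∀ (n : ℕ) (j : ℝ), (n : ℝ) * (j / 2 ^ s n) = j * (n / 2 ^ s n) := fun n j => by ring
  have hcard : ∀ n, (𝒜 n).card ≤ 3 := by
    intro n
    simp only [𝒜]
    split_ifs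
    · exact Finset.card_le_two.trans (by norm_num)
    · exact Finset.card_le_three
  have hsep : ∀ᶠ n in atTop, Separated (𝒜 n) (s n - s n / 3) := by
    filter_upwards [eventually_floor_root_ge hkHat] with n hn
    simp only [𝒜]
    split_ifs
    · exact separated_pairPattern (hs4 n hn)
    · exact separated_triplePattern (hs4 n hn)
  have hlam1 : ∀ᶠ n : ℕ in atTop,
      59 / 100 * (log n ^ 2 / log 2) ≤ n * ((𝒜 n).card / 2 ^ s n) := by
    filter_upwards [eventually_floor_root_ge hkHat, hlow] with n hn hl
    have : 0 ≤ log n ^ 2 / log 2 := by positivity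
    rw [hmul]
    simp only [𝒜]
    split_ifs with h
    · rw [card_pairPattern (hs4 n hn)]; push_cast; linarith
    · rw [card_triplePattern (hs4 n hn)]; push_cast; linarith
  have hlam2 : ∀ᶠ n : ℕ in atTop,
      n * ((𝒜 n).card / 2 ^ s n : ℝ) ≤ 102 / 100 * (log n ^ 2 / log 2) := by
    filter_upwards [eventually_floor_root_ge hkHat, hup] with n hn hl
    have : 0 ≤ log n ^ 2 / log 2 := by positivity
    rw [hmul]
    simp only [𝒜]
    split_ifs with h
    · rw [card_pairPattern (hs4 n hn)]; push_cast; linarith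
    · rw [card_triplePattern (hs4 n hn)]; push_cast; linarith
  have hP : Tendsto (fun n : ℕ => 9 / 10 * (log n ^ 2 / log 2) / (n : ℝ)) atTop (𝓝 0) := by
    have := (tendsto_log_pow_div_nat 2).const_mul (9 / 10 / log 2)
    rw [mul_zero] at this
    refine this.congr fun n => ?_
    ring
  have hB1 : Tendsto (fun n : ℕ => (s n : ℝ) / (24 / 100 * (log n ^ 2 / log 2))) atTop (𝓝 0) := by
    have := (tendsto_div_sq_log_of_div_log hs).const_mul (100 / 24 * log 2)
    rw [mul_zero] at this
    refine this.congr fun n => ?_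
    field_simp
  have hB2 : Tendsto (fun n : ℕ => exp (-(s n * (log n - log (2 * s n))) +
      9 / 10 * (log n ^ 2 / log 2) * (1 + 2 * (9 / 10 * (log n ^ 2 / log 2) / n)))) atTop
      (𝓝 0) := by
    have hs2 : Tendsto (fun n : ℕ => (2 * s n : ℝ) / log (n : ℝ)) atTop
      (𝓝 (2 * (1 / log 2))) := (hs.const_mul 2).congr fun n => (mul_div_assoc _ _ _).symm
    refine tendsto_exp_of_div_sq_log (L := -(1 / log 2 * (1 - 0)) +
      9 / 10 / log 2 * (1 + 2 * 0)) ?_ ?_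
    · have : 0 < 1 / log 2 := by positivity
      have e : 9 / 10 / log 2 = 9 / 10 * (1 / log 2) := by ring
      rw [e]
      linarith
    · refine Tendsto.congr' ?_ ((hs.mul (tendsto_const_nhds.sub
        (tendsto_log_div_log_of_div_log (by positivity) hs2))).neg.add
        ((tendsto_const_nhds (x := 9 / 10 / log 2)).mul (tendsto_const_nhds.add
          (hP.const_mul 2))))
      filter_upwards [eventually_log_pos] with n hn
      field_simp
  have hE : Tendsto (fun n : ℕ => ((s n).factorial : ℝ) / (n.descFactorial (s n) *
      (1 - (𝒜 n).card / 2 ^ s n : ℝ) ^ (n - s n))) atTop (𝓝 0) := by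
    have hsum := hB1.add hB2
    rw [add_zero] at hsum
    refine squeeze_zero' (Eventually.of_forall fun n => ?_) ?_ hsum
    · have := one_sub_div_two_pow_nonneg (𝒜 n)
      positivity
    filter_upwards [eventually_floor_root_ge hkHat, hlow, eventually_log_pos,
      eventually_gt_atTop 0, eventually_le_mul_nat_of_div_log (ε := 1 / 2) (by norm_num) hs,
      eventually_fExt_floor_root_pos hkHat, hP.eventually_le_const (by norm_num : (0 : ℝ) < 1 / 2)]
      with n hK hl hlog hn hsn hf hPn
    have hn0 : (0 : ℝ) < n := by exact_mod_cast hn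
    have hsn' : 2 * s n ≤ n := by
      have : ((2 * s n : ℕ) : ℝ) ≤ n := by push_cast; linarith
      exact_mod_cast this
    have hW : 0 < log n ^ 2 / log 2 := by positivity
    -- With two patterns λ may come arbitrarily close to the critical value W, so the exact position
    -- of the root is needed; with three patterns λ ≤ 0.9 W and the crude bound suffices.
    by_cases h : 3 / 10 * (log n ^ 2 / log 2) ≤ (n : ℝ) / 2 ^ s n
    · have h𝒜 : (𝒜 n).card = 2 := by
        simp only [𝒜, if_pos h]
        exact card_pairPattern (hs4 n hK)
      rw [h𝒜]
      refine (factorial_div_le_of_fExt_pos (by have := hs4 n hK; omega) hsn' hf).trans ?_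
      refine le_trans ?_ (le_add_of_nonneg_right (exp_pos _).le)
      rw [div_eq_mul_one_div (s n : ℝ)]
      refine mul_le_mul_of_nonneg_left ?_ (by positivity)
      rw [← one_div_div]
      gcongr
    · have h𝒜 : (𝒜 n).card = 3 := by
        simp only [𝒜, if_neg h]
        exact card_triplePattern (hs4 n hK)
      rw [h𝒜]
      have hnp : n * ((3 : ℕ) / 2 ^ s n : ℝ) ≤ 9 / 10 * (log n ^ 2 / log 2) := by
        rw [hmul]; push_cast; linarith
      have hp : ((3 : ℕ) / 2 ^ s n : ℝ) ≤ 9 / 10 * (log n ^ 2 / log 2) / n := by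
        rw [le_div_iff₀ hn0]; linarith
      refine (factorial_div_le_exp (by positivity) (hp.trans hPn) (by have := hs4 n hK; omega)
        hsn').trans ?_
      refine le_trans ?_ (le_add_of_nonneg_left (by positivity))
      gcongr
  exact ⟨𝒜, tendsto_uprob_exists_avoids hs hcard hsep hlam2 hE,
    exists_tendsto_zero_uprob_exists_avoids_comap_eq_le hs hlam1⟩

end Parameters

/-! ### Separating two random graphs -/

section Separation

theorem separationProb_eq (n : ℕ) {k : ℕ} (φ : GraphSentence k) :
    separationProb n φ = uprob (fun G : SimpleGraph (Fin n) => Models G φ) *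
      (1 - uprob fun G : SimpleGraph (Fin n) => Models G φ) := by
  rw [← uprob_not]
  exact uprob_prod (fun G : SimpleGraph (Fin n) => Models G φ) fun H => ¬ Models H φ

theorem uprob_not_hasExtensions_or_le (n m : ℕ) :
    uprob (fun p : SimpleGraph (Fin n) × SimpleGraph (Fin n) =>
      ¬ HasExtensions p.1 m ∨ ¬ HasExtensions p.2 m) ≤
      2 * uprob fun G : SimpleGraph (Fin n) => ¬ HasExtensions G m := by
  refine (uprob_or_le _ _).trans (le_of_eq ?_)
  rw [uprob_fst (fun G : SimpleGraph (Fin n) => ¬ HasExtensions G m),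
    uprob_snd (fun G : SimpleGraph (Fin n) => ¬ HasExtensions G m), two_mul]

/-- Separation forces one of the two graphs to lack the extension property; the bound does not
depend on the sentence. -/
theorem separationProb_le {n k m : ℕ} (hn : 0 < n) (hk : k ≤ m + 1) (φ : GraphSentence k) :
    separationProb n φ ≤ 2 * uprob fun G : SimpleGraph (Fin n) => ¬ HasExtensions G m := by
  have : Nonempty (Fin n) := ⟨⟨0, hn⟩⟩
  refine le_trans ?_ (uprob_not_hasExtensions_or_le n m)
  refine uprob_mono (α := SimpleGraph (Fin n) × SimpleGraph (Fin n)) fun p hp => ?_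
  by_contra! hext
  exact not_distinguishable_of_hasExtensions hk hext.1 hext.2 ⟨φ, hp⟩

/-- If single graphs are unlikely to be induced on an avoiding tuple, some family of graphs is
induced on an avoiding tuple with probability close to `1 / 2`. -/
theorem exists_family_uprob_near_half {n s : ℕ} {𝒜 : Finset (Set (Fin s))} {ε : ℝ}
    (hε : ∀ F : SimpleGraph (Fin s), uprob (fun G : SimpleGraph (Fin n) =>
      ∃ x : Fin s ↪ Fin n, G.comap x = F ∧ Avoids G 𝒜 x) ≤ ε)
    (h : 1 / 2 < uprob fun G : SimpleGraph (Fin n) => ∃ x : Fin s ↪ Fin n, Avoids G 𝒜 x) :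
    ∃ ℱ : Finset (SimpleGraph (Fin s)), |uprob (fun G : SimpleGraph (Fin n) =>
      ∃ x : Fin s ↪ Fin n, G.comap x ∈ ℱ ∧ Avoids G 𝒜 x) - 1 / 2| ≤ ε := by
  classical
  -- Discrete intermediate value argument: adding one graph raises the probability by at most ε, so
  -- the last family not exceeding 1/2 is within ε of it.
  have key : ∀ ℱ : Finset (SimpleGraph (Fin s)), 1 / 2 < uprob (fun G : SimpleGraph (Fin n) =>
      ∃ x : Fin s ↪ Fin n, G.comap x ∈ ℱ ∧ Avoids G 𝒜 x) →
      ∃ ℱ : Finset (SimpleGraph (Fin s)), |uprob (fun G : SimpleGraph (Fin n) =>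
        ∃ x : Fin s ↪ Fin n, G.comap x ∈ ℱ ∧ Avoids G 𝒜 x) - 1 / 2| ≤ ε := by
    intro ℱ
    induction ℱ using Finset.induction_on with
    | empty =>
      intro h
      simp only [Finset.notMem_empty, false_and, exists_false, uprob_false] at h
      norm_num at h
    | insert F ℱ _ ih =>
      intro hF
      by_cases hℱ : 1 / 2 < uprob (fun G : SimpleGraph (Fin n) =>
        ∃ x : Fin s ↪ Fin n, G.comap x ∈ ℱ ∧ Avoids G 𝒜 x)
      · exact ih hℱ
      · refine ⟨ℱ, ?_⟩
        have h1 : uprob (fun G : SimpleGraph (Fin n) =>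
            ∃ x : Fin s ↪ Fin n, G.comap x ∈ insert F ℱ ∧ Avoids G 𝒜 x) ≤
            uprob (fun G : SimpleGraph (Fin n) =>
              ∃ x : Fin s ↪ Fin n, G.comap x = F ∧ Avoids G 𝒜 x) +
            uprob (fun G : SimpleGraph (Fin n) =>
              ∃ x : Fin s ↪ Fin n, G.comap x ∈ ℱ ∧ Avoids G 𝒜 x) := by
          refine le_trans (uprob_mono fun G => ?_) (uprob_or_le _ _)
          rintro ⟨x, hx, hav⟩
          rcases Finset.mem_insert.1 hx with hx | hx
          · exact Or.inl ⟨x, hx, hav⟩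
          · exact Or.inr ⟨x, hx, hav⟩
        have h2 := hε F
        rw [abs_le]
        constructor <;> linarith
  refine key Finset.univ ?_
  simpa using h

variable {kHat : ℕ → ℝ}

/-- Tuples of length ⌊k̂⌋ + 2 and one further variable: three extra variables already suffice, and
more do no harm. -/
theorem exists_tendsto_separationProb (hkHat : ∀ᶠ n : ℕ in atTop,
      kHat n ∈ Set.Icc (1 : ℝ) (n : ℝ) ∧ fExt n (kHat n) = 0) {a : ℕ} (ha : 3 ≤ a) :
    ∃ φ : (n : ℕ) → GraphSentence (⌊kHat n⌋₊ + a),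
      Tendsto (fun n : ℕ => separationProb n (φ n)) atTop (𝓝 (1 / 4)) := by
  obtain ⟨𝒜, hex, ε, hε, hF⟩ := exists_patterns hkHat
  have hφ : ∀ n, ∃ φ : GraphSentence (⌊kHat n⌋₊ + a),
      0 < n → (∀ F : SimpleGraph (Fin (⌊kHat n⌋₊ + 2)),
        uprob (fun G : SimpleGraph (Fin n) => ∃ x : Fin (⌊kHat n⌋₊ + 2) ↪ Fin n,
          G.comap x = F ∧ Avoids G (𝒜 n) x) ≤ ε n) →
      (1 / 2 < uprob fun G : SimpleGraph (Fin n) =>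
        ∃ x : Fin (⌊kHat n⌋₊ + 2) ↪ Fin n, Avoids G (𝒜 n) x) →
      |uprob (fun G : SimpleGraph (Fin n) => Models G φ) - 1 / 2| ≤ ε n := by
    intro n
    by_cases h : 0 < n ∧ (∀ F : SimpleGraph (Fin (⌊kHat n⌋₊ + 2)),
        uprob (fun G : SimpleGraph (Fin n) => ∃ x : Fin (⌊kHat n⌋₊ + 2) ↪ Fin n,
          G.comap x = F ∧ Avoids G (𝒜 n) x) ≤ ε n) ∧
      (1 / 2 < uprob fun G : SimpleGraph (Fin n) =>
        ∃ x : Fin (⌊kHat n⌋₊ + 2) ↪ Fin n, Avoids G (𝒜 n) x)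
    · obtain ⟨ℱ, hℱ⟩ := exists_family_uprob_near_half h.2.1 h.2.2
      have : Nonempty (Fin n) := ⟨⟨0, h.1⟩⟩
      refine ⟨(configFormula (by omega) (𝒜 n) ℱ).exClosure, fun _ _ _ => ?_⟩
      simpa only [models_configFormula] using hℱ
    -- A dummy sentence for the n at which the estimates are not yet available.
    · exact ⟨GraphFormula.exClosure .falsum, fun h1 h2 h3 => (h ⟨h1, h2, h3⟩).elim⟩
  choose φ hφ using hφ
  refine ⟨φ, ?_⟩
  have hP : Tendsto (fun n => uprob (fun G : SimpleGraph (Fin n) => Models G (φ n)) - 1 / 2) atTop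
      (𝓝 0) := by
    refine squeeze_zero_norm' ?_ hε
    filter_upwards [hF, hex.eventually_const_lt (by norm_num : (1 : ℝ) / 2 < 1),
      eventually_gt_atTop 0] with n h1 h2 h3
    exact hφ n h3 h1 h2
  -- P(1 - P) = 1/4 - (P - 1/2)².
  have := (hP.pow 2).const_sub (1 / 4)
  norm_num only at this
  refine this.congr fun n => ?_
  rw [separationProb_eq]
  ring

theorem tendsto_pairProb_isLeast_distinguishable (hkHat : ∀ᶠ n : ℕ in atTop,
      kHat n ∈ Set.Icc (1 : ℝ) (n : ℝ) ∧ fExt n (kHat n) = 0) :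
    Tendsto (fun n : ℕ => pairProb n fun G H =>
      ∃ m ∈ Set.Icc (⌊kHat n⌋₊ + 1) (⌊kHat n⌋₊ + 3), IsLeast {k : ℕ | Distinguishable k G H} m)
      atTop (𝓝 1) := by
  obtain ⟨𝒜, hex, ε, hε, hF⟩ := exists_patterns hkHat
  have hext := tendsto_uprob_not_hasExtensions_floor_root hkHat
  have hlow : Tendsto (fun n : ℕ => uprob (fun G : SimpleGraph (Fin n) =>
      ∃ x : Fin (⌊kHat n⌋₊ + 2) ↪ Fin n, Avoids G (𝒜 n) x) -
      2 * uprob (fun G : SimpleGraph (Fin n) => ¬ HasExtensions G (⌊kHat n⌋₊ - 1)) - ε n) atTop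
      (𝓝 1) := by
    simpa using (hex.sub (hext.const_mul 2)).sub hε
  refine tendsto_of_tendsto_of_tendsto_of_le_of_le' hlow tendsto_const_nhds ?_
    (Eventually.of_forall fun n => uprob_le_one
      (α := SimpleGraph (Fin n) × SimpleGraph (Fin n)) _)
  filter_upwards [hF, eventually_floor_root_ge hkHat, eventually_gt_atTop 0] with n hFn hK hn
  have : Nonempty (Fin n) := ⟨⟨0, hn⟩⟩
  -- The graph F is read off from an avoiding tuple of the first graph, so the distinguishing
  -- sentence depends on that graph alone.
  have hchoice : ∀ G : SimpleGraph (Fin n), ∃ F : SimpleGraph (Fin (⌊kHat n⌋₊ + 2)),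
      (∃ x : Fin (⌊kHat n⌋₊ + 2) ↪ Fin n, Avoids G (𝒜 n) x) →
      ∃ x : Fin (⌊kHat n⌋₊ + 2) ↪ Fin n, G.comap x = F ∧ Avoids G (𝒜 n) x := by
    intro G
    by_cases h : ∃ x : Fin (⌊kHat n⌋₊ + 2) ↪ Fin n, Avoids G (𝒜 n) x
    · obtain ⟨x, hx⟩ := h
      exact ⟨G.comap x, fun _ => ⟨x, rfl, hx⟩⟩
    · exact ⟨⊥, fun h' => (h h').elim⟩
  choose F hFG using hchoice
  let E : SimpleGraph (Fin n) × SimpleGraph (Fin n) → Prop := fun p =>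
    ∃ m ∈ Set.Icc (⌊kHat n⌋₊ + 1) (⌊kHat n⌋₊ + 3),
      IsLeast {k : ℕ | Distinguishable k p.1 p.2} m
  let B₁ : SimpleGraph (Fin n) × SimpleGraph (Fin n) → Prop := fun p =>
    ¬ HasExtensions p.1 (⌊kHat n⌋₊ - 1) ∨ ¬ HasExtensions p.2 (⌊kHat n⌋₊ - 1)
  let B₂ : SimpleGraph (Fin n) × SimpleGraph (Fin n) → Prop := fun p =>
    ¬ ∃ x : Fin (⌊kHat n⌋₊ + 2) ↪ Fin n, Avoids p.1 (𝒜 n) x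
  let B₃ : SimpleGraph (Fin n) × SimpleGraph (Fin n) → Prop := fun p =>
    ∃ x : Fin (⌊kHat n⌋₊ + 2) ↪ Fin n, p.2.comap x = F p.1 ∧ Avoids p.2 (𝒜 n) x
  have hsub : ∀ p, ¬ E p → B₁ p ∨ B₂ p ∨ B₃ p := by
    intro p hp
    by_contra! hB
    obtain ⟨h1, h2, h3⟩ := hB
    simp only [B₁, not_or, not_not] at h1
    simp only [B₂, not_not] at h2
    have hne : Distinguishable (⌊kHat n⌋₊ + 3) p.1 p.2 := by
      refine ⟨(configFormula le_rfl (𝒜 n) {F p.1}).exClosure, ?_, ?_⟩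
      · rw [models_configFormula]
        simpa using hFG p.1 h2
      · rw [models_configFormula]
        simpa [B₃] using h3
    refine hp ⟨sInf {k : ℕ | Distinguishable k p.1 p.2}, ⟨?_, ?_⟩, ?_, ?_⟩
    · by_contra! hlt
      exact not_distinguishable_of_hasExtensions (by omega) h1.1 h1.2
        (Nat.sInf_mem (s := {k : ℕ | Distinguishable k p.1 p.2}) ⟨_, hne⟩)
    · exact Nat.sInf_le hne
    · exact Nat.sInf_mem (s := {k : ℕ | Distinguishable k p.1 p.2}) ⟨_, hne⟩
    · exact fun k hk => Nat.sInf_le hk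
  have h1 : uprob (fun p => ¬ E p) ≤ uprob B₁ + (uprob B₂ + uprob B₃) :=
    (uprob_mono hsub).trans ((uprob_or_le _ _).trans
      (add_le_add_right (uprob_or_le _ _) _))
  have h2 : uprob B₁ ≤ 2 * uprob (fun G : SimpleGraph (Fin n) =>
      ¬ HasExtensions G (⌊kHat n⌋₊ - 1)) := uprob_not_hasExtensions_or_le n _
  have h3 : uprob B₂ = 1 - uprob (fun G : SimpleGraph (Fin n) =>
      ∃ x : Fin (⌊kHat n⌋₊ + 2) ↪ Fin n, Avoids G (𝒜 n) x) := by
    rw [← uprob_not]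
    exact uprob_fst (fun G : SimpleGraph (Fin n) =>
      ¬ ∃ x : Fin (⌊kHat n⌋₊ + 2) ↪ Fin n, Avoids G (𝒜 n) x)
  -- Conditionally on the first graph, F is fixed and the second graph is still uniform, so the
  -- bound uniform in F applies.
  have h4 : uprob B₃ ≤ ε n := uprob_prod_le (fun G H : SimpleGraph (Fin n) =>
    ∃ x : Fin (⌊kHat n⌋₊ + 2) ↪ Fin n, H.comap x = F G ∧ Avoids H (𝒜 n) x) fun G => hFn (F G)
  have h5 := uprob_not E
  change _ ≤ uprob E
  linarith

end Separation

end RandomGraphLogic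

/-! ### Assembly of the theorem -/

theorem theorem1 (kHat : ℕ → ℝ)
    (hkHat : ∀ᶠ n : ℕ in Filter.atTop,
      kHat n ∈ Set.Icc (1 : ℝ) (n : ℝ) ∧ RandomGraphLogic.fExt n (kHat n) = 0) :
    -- the root exists and is unique, for all large `n`
    (∀ᶠ n : ℕ in Filter.atTop,
      ∃! x : ℝ, x ∈ Set.Icc (1 : ℝ) (n : ℝ) ∧ RandomGraphLogic.fExt n x = 0) ∧
    -- its asymptotics
    Filter.Tendsto
      (fun n : ℕ => kHat n -
        (Real.logb 2 (n : ℝ) - 2 * Real.logb 2 (Real.log (n : ℝ)) + Real.logb 2 (Real.log 2)))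
      Filter.atTop (nhds 0) ∧
    -- part 1: the least number of variables of a fixed sentence that separates the two graphs with
    -- probability at least `1/4 - ε`, for each fixed `ε`
    (∀ ε : ℝ, 0 < ε → ε < 1 / 4 → ∀ᶠ n : ℕ in Filter.atTop,
      ∃ m ∈ Set.Icc (⌊kHat n⌋₊ + 1) (⌊kHat n⌋₊ + 4),
        IsLeast {k : ℕ | ∃ φ : RandomGraphLogic.GraphSentence k,
          1 / 4 - ε ≤ RandomGraphLogic.separationProb n φ} m) ∧
    -- part 1, in terms of sequences of sentences: probability `1/4 - o(1)` is attained
    (∃ φ : (n : ℕ) → RandomGraphLogic.GraphSentence (⌊kHat n⌋₊ + 4),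
      Filter.Tendsto (fun n : ℕ => RandomGraphLogic.separationProb n (φ n))
        Filter.atTop (nhds (1 / 4))) ∧
    -- and it is never attained with fewer than `⌊kHat n⌋₊ + 1` variables
    (∀ (k : ℕ → ℕ) (φ : (n : ℕ) → RandomGraphLogic.GraphSentence (k n)),
      Filter.Tendsto (fun n : ℕ => RandomGraphLogic.separationProb n (φ n))
        Filter.atTop (nhds (1 / 4)) →
      ∀ᶠ n : ℕ in Filter.atTop, ⌊kHat n⌋₊ + 1 ≤ k n) ∧
    -- part 2: with high probability, the least `k` for which the two graphs are `k`-distinguishable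
    Filter.Tendsto
      (fun n : ℕ => RandomGraphLogic.pairProb n fun G H =>
        ∃ m ∈ Set.Icc (⌊kHat n⌋₊ + 1) (⌊kHat n⌋₊ + 3),
          IsLeast {k : ℕ | RandomGraphLogic.Distinguishable k G H} m)
      Filter.atTop (nhds 1) := by
  open RandomGraphLogic in
  obtain ⟨φ, hφ⟩ := exists_tendsto_separationProb hkHat (a := 4) (by norm_num)
  -- Uniformly over all sentences with at most ⌊k̂⌋ variables the separation probability tends to 0;
  -- this gives both lower bounds of part 1.
  have hsmall : ∀ δ : ℝ, 0 < δ → ∀ᶠ n : ℕ in Filter.atTop, ∀ k ≤ ⌊kHat n⌋₊,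
      ∀ ψ : GraphSentence k, separationProb n ψ < δ := by
    intro δ hδ
    have h := (tendsto_uprob_not_hasExtensions_floor_root hkHat).const_mul 2
    rw [mul_zero] at h
    filter_upwards [h.eventually_lt_const hδ, eventually_floor_root_ge hkHat,
      Filter.eventually_gt_atTop 0] with n h1 h2 h3 k hk ψ
    exact (separationProb_le h3 (by omega) ψ).trans_lt h1
  refine ⟨?_, tendsto_root_sub hkHat, ?_, ⟨φ, hφ⟩, ?_, tendsto_pairProb_isLeast_distinguishable hkHat⟩
  · filter_upwards [Filter.eventually_ge_atTop 6] with n hn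
    exact existsUnique_fExt_eq_zero hn
  · intro ε hε hε4
    filter_upwards [hsmall (1 / 4 - ε) (by linarith),
      hφ.eventually_const_le (by linarith : 1 / 4 - ε < 1 / 4)] with n h1 h2
    set S := {k : ℕ | ∃ φ : GraphSentence k, 1 / 4 - ε ≤ separationProb n φ} with hS
    have hne : ⌊kHat n⌋₊ + 4 ∈ S := ⟨φ n, h2⟩
    refine ⟨sInf S, ⟨?_, Nat.sInf_le hne⟩, Nat.sInf_mem ⟨_, hne⟩, fun k hk => Nat.sInf_le hk⟩
    by_contra! hlt
    obtain ⟨ψ, hψ⟩ := Nat.sInf_mem ⟨_, hne⟩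
    exact (h1 _ (by omega) ψ).not_ge hψ
  · intro k ψ hψ
    filter_upwards [hsmall (1 / 8) (by norm_num),
      hψ.eventually_const_lt (by norm_num : (1 : ℝ) / 8 < 1 / 4)] with n h1 h2
    by_contra! hlt
    exact (h1 _ (by omega) (ψ n)).not_gt h2
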